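/- Let $A$ and $B$ be quantum systems of finite dimensions $d_A$ and $d_B$ (no ancillas), and let $d=\min(d_A,d_B)$. Let $H$ be a Hermitian operator and $(L_\alpha)_\alpha$ a finite family of operators on $\mathbb C^{d_A}\otimes\mathbb C^{d_B}$, and let $$\mathcal L(\rho)=-i[H,\rho]+\sum_\alpha\Bigl(L_\alpha\rho L_\alpha^\dagger-\tfrac12L_\alpha^\dagger L_\alpha\rho-\tfrac12\rho L_\alpha^\dagger L_\alpha\Bigr).$$ For a state $\rho$ let $$D(\rho)=\min_{\sigma\ \text{separable}}\operatorname{Tr}(\rho\ln\rho-\rho\ln\sigma)$$ be the relative entropy of entanglement, where $\sigma$ ranges over the finite convex combinations of product states $\sigma_A\otimes\sigma_B$, and where the relative entropy is $+\infty$ if the support of $\rho$ is not contained in that of $\sigma$. Then for every $\epsilon>0$ there exists $\delta>0$ such that for every unit vector $\Psi\in\mathbb C^{d_A}\otimes\mathbb C^{d_B}$ and every $0<\Delta t<\delta$, the solution of $\frac{d}{dt}\rho(t)=\mathcal L(\rho(t))$, $t\ge 0$, with $\rho(0)=|\Psi\rangle\langle\Psi|$ satisfies $$\Gamma_R(\Psi,\mathcal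 L,\Delta t):=\frac{D(\rho(\Delta t))-D(\rho(0))}{\Delta t}\le 4\Bigl(\|H\|+86\sum_\alpha\|L_\alpha\|^2\Bigr)\ln d+\epsilon,$$ where $\|\cdot\|$ is the operator norm. -/

import Mathlib

-- `‖·‖` on matrices is the operator norm induced by the Euclidean norm.
open scoped Matrix Matrix.Norms.L2Operator Kronecker ComplexOrder

noncomputable section

namespace EntRate

/-- Operators on the Hilbert space with orthonormal basis indexed by `n`. -/
abbrev Op (n : Type*) := Matrix n n ℂ

section General

variable {n : Type*} [Fintype n] [DecidableEq n]

/-- A quantum state: a positive semidefinite operator of trace one. -/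
def IsState (ρ : Op n) : Prop := ρ.PosSemidef ∧ ρ.trace = 1

/-- The rank-one operator `|Ψ⟩⟨Ψ|`. -/
def pureState (Ψ : EuclideanSpace ℂ n) : Op n :=
  Matrix.vecMulVec (fun i => Ψ i) (fun i => star (Ψ i))

open Classical in
/-- The relative entropy `D(ρ‖σ) = Tr (ρ ln ρ - ρ ln σ)` if the support of `ρ` is contained in
the support of `σ` (equivalently, `ker σ ⊆ ker ρ`), and `+∞` otherwise. The logarithm is taken
through the spectral decomposition; as `Real.log 0 = 0`, it vanishes on the kernel, which is the
usual convention `0 ln 0 = 0`. -/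
def relEntropy (ρ σ : Op n) : EReal :=
  if LinearMap.ker (Matrix.toLin' σ) ≤ LinearMap.ker (Matrix.toLin' ρ) then
    (((ρ * cfc Real.log ρ - ρ * cfc Real.log σ).trace.re : ℝ) : EReal)
  else ⊤

/-- The generator in Lindblad form with Hamiltonian `H` and Lindblad operators `L α`. -/
def lindblad {κ : Type*} [Fintype κ] (H : Op n) (L : κ → Op n) (ρ : Op n) : Op n :=
  -Complex.I • (H * ρ - ρ * H) +
    ∑ α, (L α * ρ * (L α)ᴴ - (1 / 2 : ℂ) • ((L α)ᴴ * L α * ρ)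
      - (1 / 2 : ℂ) • (ρ * ((L α)ᴴ * L α)))

/-- `ρ` solves `dρ/dt = 𝓛(ρ(t))` for `t ≥ 0` (one-sided derivative at `t = 0`), where `𝓛` is the
generator with Hamiltonian `H` and Lindblad operators `L α`. -/
def IsEvolution {κ : Type*} [Fintype κ] (H : Op n) (L : κ → Op n) (ρ : ℝ → Op n) : Prop :=
  ∀ t : ℝ, 0 ≤ t → HasDerivWithinAt ρ (lindblad H L (ρ t)) (Set.Ici 0) t

end General

section Bipartite

variable {A B : Type*} [Fintype A] [DecidableEq A] [Fintype B] [DecidableEq B]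

/-- Separable states: finite convex combinations of product states `σ_A ⊗ σ_B`. -/
def separableStates (A B : Type*) [Fintype A] [DecidableEq A] [Fintype B] [DecidableEq B] :
    Set (Op (A × B)) :=
  convexHull ℝ {σ | ∃ (σA : Op A) (σB : Op B), IsState σA ∧ IsState σB ∧ σ = σA ⊗ₖ σB}

/-- The relative entropy of entanglement, `min_{σ separable} D(ρ‖σ)`. -/
def relEntropyEntanglement (ρ : Op (A × B)) : EReal :=
  ⨅ σ ∈ separableStates A B, relEntropy ρ σ

/-- The entangling rate `(E(ρ(Δt)) - E(ρ(0))) / Δt` along the trajectory `ρ`, where `E` is the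
relative entropy of entanglement (which is finite on states). -/
def entanglingRate (ρ : ℝ → Op (A × B)) (Δt : ℝ) : ℝ :=
  ((relEntropyEntanglement (ρ Δt)).toReal - (relEntropyEntanglement (ρ 0)).toReal) / Δt

end Bipartite

end EntRate

end

/-! For small t the state ρ(t) is nearly pure. Put S = ∑‖L_α‖² and v = ‖H‖ + 3S/2. Up to a phase and
O(t²), the top eigenvector of ρ(t) lies within t v of Ψ, and the other eigenvectors carry total
weight at most t S (`exists_lindblad_pureState_mulVec`, `neg_sum_le_quadForm_lindblad`,
`exists_top_eigenvector`).

Upper bound on D(ρ(t)): choose a separable σ_k for each eigenvector z_k and use the trial state ∑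
p_k σ_k. Operator monotonicity of the logarithm cancels the terms p_k ln p_k, leaving the mean of
-⟨z_k, ln σ_k z_k⟩ (`relEntropyEntanglement_le_sum`). The top eigenvector gets the Schmidt-diagonal
state of Ψ with a little white noise; each other eigenvector gets its own such state, at a cost of
about 2 ln d.

Lower bound on D(Ψ): the reduction criterion σ ≤ τ ⊗ 1 shows that it is at least the entropy of the
squared Schmidt coefficients (`schmidtEntropy_le_toReal`). In the difference this entropy cancels.

What remains to first order is the displacement of the top eigenvector. Cauchy-Schwarz bounds it by
2·(t v)·(second moment of the surprisal)^(1/2), and a distribution with at most d atoms has second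
moment at most (2 ln d)² (`sum_mul_log_sq_le`). The limiting rate is therefore at most 4 v ln d + 2
S ln d = 4(‖H‖ + 2S) ln d, below the claim. All errors depend only on H, L and the dimensions, so δ
is uniform in Ψ. -/

open scoped MatrixOrder

set_option linter.unusedSectionVars false

namespace EntRate

/-! ### Quadratic forms, functional calculus and the operator logarithm. -/

section QuadraticForm

variable {n m : Type*} [Fintype n] [DecidableEq n] [Fintype m] [DecidableEq m]

/-- The real part of the quadratic form `⟨v, X v⟩`. -/
noncomputable def quadForm (X : Matrix n n ℂ) (v : n → ℂ) : ℝ := (star v ⬝ᵥ X *ᵥ v).re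

/-- The Hermitian matrix with eigenvalues `s` in the orthonormal basis of columns of `U`. -/
noncomputable def spectralMatrix (U : Matrix n n ℂ) (s : n → ℝ) : Matrix n n ℂ :=
  U * Matrix.diagonal (fun k => (s k : ℂ)) * Uᴴ

lemma isHermitian_spectralMatrix (U : Matrix n n ℂ) (s : n → ℝ) :
    (spectralMatrix U s).IsHermitian := by
  unfold spectralMatrix
  apply Matrix.isHermitian_mul_mul_conjTranspose
  rw [Matrix.isHermitian_diagonal_iff]
  intro i
  simp [IsSelfAdjoint]

lemma exists_spectralMatrix {X : Matrix n n ℂ} (hX : X.IsHermitian) :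
    ∃ U ∈ Matrix.unitaryGroup n ℂ, X = spectralMatrix U hX.eigenvalues := by
  refine ⟨hX.eigenvectorUnitary, hX.eigenvectorUnitary.2, ?_⟩
  conv_lhs => rw [hX.spectral_theorem]
  rfl

/-- Diagonal matrices in the basis of columns of a unitary `U`, as an algebra homomorphism. -/
noncomputable def spectralAlgHom {U : Matrix n n ℂ} (hU : U ∈ Matrix.unitaryGroup n ℂ) :
    (n → ℝ) →ₐ[ℝ] Matrix n n ℂ where
  toFun := fun s => spectralMatrix U s
  map_one' := by
    have := Matrix.mem_unitaryGroup_iff.1 hU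
    rw [Matrix.star_eq_conjTranspose] at this
    simpa [spectralMatrix] using this
  map_mul' := fun s t => by
    have := Matrix.mem_unitaryGroup_iff'.1 hU
    rw [Matrix.star_eq_conjTranspose] at this
    simp only [spectralMatrix, Pi.mul_apply, Complex.ofReal_mul, ← Matrix.diagonal_mul_diagonal]
    simp only [Matrix.mul_assoc]
    rw [← Matrix.mul_assoc Uᴴ U, this, Matrix.one_mul]
  map_zero' := by simp [spectralMatrix]
  map_add' := fun s t => by
    simp only [spectralMatrix, Pi.add_apply, Complex.ofReal_add, ← Matrix.diagonal_add,
      Matrix.mul_add, Matrix.add_mul]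
  commutes' := fun r => by
    have := Matrix.mem_unitaryGroup_iff.1 hU
    rw [Matrix.star_eq_conjTranspose] at this
    have h2 : (Matrix.diagonal fun k : n => (((algebraMap ℝ (n → ℝ)) r k : ℝ) : ℂ))
        = (r : ℂ) • (1 : Matrix n n ℂ) := by
      ext i j; by_cases h : i = j <;> simp [h]
    simp only [spectralMatrix]
    rw [h2]
    simp [this, Algebra.algebraMap_eq_smul_one]

/-- On a finite set any `f` agrees with its Lagrange interpolant, and polynomials commute with the
algebra homomorphism `spectralAlgHom`. Interpolating on the spectrum together with the values of `s`
avoids having to identify the two. -/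
lemma cfc_spectralMatrix (f : ℝ → ℝ) {U : Matrix n n ℂ} (hU : U ∈ Matrix.unitaryGroup n ℂ)
    (s : n → ℝ) : cfc f (spectralMatrix U s) = spectralMatrix U (f ∘ s) := by
  classical
  set X := spectralMatrix U s
  have hX : IsSelfAdjoint X := isHermitian_spectralMatrix U s
  let S : Finset ℝ := (X.finite_real_spectrum).toFinset ∪ Finset.univ.image s
  let q : Polynomial ℝ := Lagrange.interpolate S id f
  have hq : ∀ x ∈ S, q.eval x = f x := fun x hx =>
    Lagrange.eval_interpolate_at_node f (Set.injOn_id _) hx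
  have h1 : cfc f X = cfc q.eval X :=
    cfc_congr fun x hx => (hq x (by simp [S, hx])).symm
  rw [h1, cfc_polynomial q X hX]
  have h2 := Polynomial.aeval_algHom_apply (spectralAlgHom hU) s q
  change Polynomial.aeval X q = spectralMatrix U _ at h2
  rw [h2]
  congr 1
  ext k
  rw [Polynomial.aeval_pi_apply]
  change Polynomial.aeval (s k) q = f (s k)
  rw [Polynomial.coe_aeval_eq_eval]
  exact hq _ (by simp [S])

lemma quadForm_spectralMatrix (U : Matrix n n ℂ) (s : n → ℝ) (v : n → ℂ) :
    quadForm (spectralMatrix U s) v = ∑ k, s k * ‖(Uᴴ *ᵥ v) k‖ ^ 2 := by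
  have : star v ⬝ᵥ spectralMatrix U s *ᵥ v
      = star (Uᴴ *ᵥ v) ⬝ᵥ (Matrix.diagonal fun k => (s k : ℂ)) *ᵥ (Uᴴ *ᵥ v) := by
    rw [Matrix.star_mulVec, Matrix.conjTranspose_conjTranspose, ← Matrix.dotProduct_mulVec,
      Matrix.mulVec_mulVec, Matrix.mulVec_mulVec, spectralMatrix, Matrix.mul_assoc]
  rw [quadForm, this, dotProduct, Complex.re_sum]
  refine Finset.sum_congr rfl fun k _ => ?_
  rw [Matrix.mulVec_diagonal, Pi.star_apply, mul_left_comm, ← Complex.normSq_eq_norm_sq,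
    Complex.star_def, ← Complex.normSq_eq_conj_mul_self, ← Complex.ofReal_mul, Complex.ofReal_re]

lemma quadForm_mono {X Y : Matrix n n ℂ} (h : X ≤ Y) (v : n → ℂ) :
    quadForm X v ≤ quadForm Y v := by
  have := (Matrix.le_iff.1 h).re_dotProduct_nonneg v
  rw [Matrix.sub_mulVec, dotProduct_sub] at this
  simpa [quadForm] using this

lemma quadForm_add (X Y : Matrix n n ℂ) (v : n → ℂ) :
    quadForm (X + Y) v = quadForm X v + quadForm Y v := by
  simp [quadForm, Matrix.add_mulVec, dotProduct_add]

lemma quadForm_smul (c : ℝ) (X : Matrix n n ℂ) (v : n → ℂ) :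
    quadForm (c • X) v = c * quadForm X v := by
  simp [quadForm, Matrix.smul_mulVec, dotProduct_smul]

lemma quadForm_one (v : n → ℂ) : quadForm 1 v = ∑ k, ‖v k‖ ^ 2 := by
  have := quadForm_spectralMatrix 1 1 v
  simpa [spectralMatrix] using this

/-- Operator monotonicity of the logarithm: the one place where logarithms of non-commuting
operators are compared. -/
lemma quadForm_log_mono {X Y : Matrix n n ℂ} (hX : X.PosDef) (h : X ≤ Y) (v : n → ℂ) :
    quadForm (cfc Real.log X) v ≤ quadForm (cfc Real.log Y) v :=
  quadForm_mono (CFC.log_le_log h hX.isStrictlyPositive) v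

/-- The tangent line inequality `log X ≤ X / c - 1 + log c`. -/
lemma quadForm_log_le {X : Matrix n n ℂ} (hX : X.PosDef) {c : ℝ} (hc : 0 < c) (v : n → ℂ) :
    quadForm (cfc Real.log X) v ≤ quadForm X v / c + (Real.log c - 1) * quadForm 1 v := by
  obtain ⟨U, hU, h⟩ := exists_spectralMatrix hX.1
  have hpos := hX.eigenvalues_pos
  generalize hX.1.eigenvalues = s at h hpos
  have h1 : (1 : Matrix n n ℂ) = spectralMatrix U 1 := (map_one (spectralAlgHom hU)).symm
  rw [h1, h, cfc_spectralMatrix _ hU, quadForm_spectralMatrix, quadForm_spectralMatrix,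
    quadForm_spectralMatrix, Finset.sum_div, Finset.mul_sum, ← Finset.sum_add_distrib]
  refine Finset.sum_le_sum fun k _ => ?_
  have h2 := Real.log_le_sub_one_of_pos (div_pos (hpos k) hc)
  rw [Real.log_div (hpos k).ne' hc.ne'] at h2
  have h3 : Real.log (s k) ≤ s k / c + (Real.log c - 1) := by linarith
  calc _ ≤ (s k / c + (Real.log c - 1)) * ‖(Uᴴ *ᵥ v) k‖ ^ 2 := by
        gcongr; exact h3
    _ = _ := by simp only [Pi.one_apply]; ring

lemma kronecker_mem_unitaryGroup {U : Matrix n n ℂ} {V : Matrix m m ℂ}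
    (hU : U ∈ Matrix.unitaryGroup n ℂ) (hV : V ∈ Matrix.unitaryGroup m ℂ) :
    U ⊗ₖ V ∈ Matrix.unitaryGroup (n × m) ℂ :=
  Matrix.kronecker_mem_unitary hU hV

lemma spectralMatrix_kronecker (U : Matrix n n ℂ) (V : Matrix m m ℂ) (s : n → ℝ) (t : m → ℝ) :
    spectralMatrix U s ⊗ₖ spectralMatrix V t
      = spectralMatrix (U ⊗ₖ V) (fun k => s k.1 * t k.2) := by
  simp only [spectralMatrix, Matrix.mul_kronecker_mul, Matrix.conjTranspose_kronecker,
    Matrix.diagonal_kronecker_diagonal, Complex.ofReal_mul]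

lemma cfc_kronecker_one (f : ℝ → ℝ) {X : Matrix n n ℂ} (hX : X.IsHermitian) :
    cfc f (X ⊗ₖ (1 : Matrix m m ℂ)) = cfc f X ⊗ₖ (1 : Matrix m m ℂ) := by
  obtain ⟨U, hU, h⟩ := exists_spectralMatrix hX
  generalize hX.eigenvalues = s at h
  have h1 : (1 : Matrix m m ℂ) = spectralMatrix 1 1 := by simp [spectralMatrix]
  rw [h, h1, cfc_spectralMatrix f hU, spectralMatrix_kronecker, spectralMatrix_kronecker,
    cfc_spectralMatrix f (kronecker_mem_unitaryGroup hU (one_mem _))]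
  congr 1
  ext k
  simp

end QuadraticForm
end EntRate

namespace EntRate

/-! ### Second moment of the surprisal. -/

section Surprisal

/-- If -ln p ≤ ln d, the first term suffices. Otherwise p = e^{-u}/d with u ≥ 0, and the excess 2u
ln d + u² is at most 2 (ln d) e^u because ln d ≥ 1; this is where d ≥ 3 enters. -/
lemma mul_log_sq_le {p d : ℝ} (hp : 0 < p) (hp1 : p ≤ 1) (hd : 3 ≤ d) :
    p * Real.log p ^ 2 ≤ p * Real.log d ^ 2 + 2 * Real.log d / d := by
  have hd0 : 0 < d := by linarith
  have hl : 1 ≤ Real.log d := by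
    rw [Real.le_log_iff_exp_le hd0]
    linarith [Real.exp_one_lt_d9]
  have hlp : Real.log p ≤ 0 := Real.log_nonpos hp.le hp1
  have h2 : 0 ≤ 2 * Real.log d / d := by positivity
  rcases le_total (-Real.log p) (Real.log d) with h | h
  · have : Real.log p ^ 2 ≤ Real.log d ^ 2 := by nlinarith
    nlinarith
  · obtain ⟨u, hu⟩ : ∃ u, u = -Real.log p - Real.log d := ⟨_, rfl⟩
    have hu0 : 0 ≤ u := by linarith
    have he := Real.quadratic_le_exp_of_nonneg hu0
    have hpe : p * Real.exp u = 1 / d := by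
      rw [hu, Real.exp_sub, Real.exp_neg, Real.exp_log hp, Real.exp_log hd0]
      field_simp
    have h3 : Real.log p = -(Real.log d + u) := by linarith
    have h4 : 2 * Real.log d / d = 2 * Real.log d * (p * Real.exp u) := by rw [hpe]; ring
    rw [h3, h4]
    have h5 : 2 * Real.log d * u + u ^ 2 ≤ 2 * Real.log d * Real.exp u := by nlinarith
    nlinarith

/-- The maximum is 4/e², at p = e^{-2}; it comes from w e^{-w} ≤ e^{-1} with p = e^{-2w}. It serves
the case d = 2. -/
lemma mul_log_sq_le_const {p : ℝ} (hp : 0 < p) (hp1 : p ≤ 1) :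
    p * Real.log p ^ 2 ≤ 3 / 5 := by
  obtain ⟨w, hw⟩ : ∃ w, w = -Real.log p / 2 := ⟨_, rfl⟩
  have hw0 : 0 ≤ w := by have := Real.log_nonpos hp.le hp1; linarith
  have h1 : w ≤ Real.exp (w - 1) := by linarith [Real.add_one_le_exp (w - 1)]
  have h2 : p = Real.exp (-w) ^ 2 := by
    rw [← Real.exp_nat_mul, hw]; push_cast
    rw [show (2 : ℝ) * -(-Real.log p / 2) = Real.log p by ring, Real.exp_log hp]
  have h3 : w * Real.exp (-w) ≤ Real.exp (-1) := by
    calc w * Real.exp (-w) ≤ Real.exp (w - 1) * Real.exp (-w) := by gcongr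
      _ = Real.exp (-1) := by rw [← Real.exp_add]; congr 1; ring
  have h4 : Real.exp (-1) ≤ 0.37 := by linarith [Real.exp_neg_one_lt_d9]
  have h5 : 0 ≤ w * Real.exp (-w) := by positivity
  have h6 : p * Real.log p ^ 2 = 4 * (w * Real.exp (-w)) ^ 2 := by
    rw [show Real.log p = -2 * w by rw [hw]; ring]
    conv_lhs => rw [h2]
    ring
  rw [h6]; nlinarith

/-- The second moment of the surprisal of a distribution with at most `d` atoms. -/
lemma sum_mul_log_sq_le {ι : Type*} [Fintype ι] {p : ι → ℝ} (hp : ∀ k, 0 ≤ p k)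
    (hsum : ∑ k, p k = 1) {d : ℕ} (hcard : (Finset.univ.filter fun k => p k ≠ 0).card ≤ d) :
    ∑ k, p k * Real.log (p k) ^ 2 ≤ (2 * Real.log d) ^ 2 := by
  classical
  set T := Finset.univ.filter fun k => p k ≠ 0 with hT
  have hle : ∀ k, p k ≤ 1 := fun k => by
    rw [← hsum]; exact Finset.single_le_sum (fun i _ => hp i) (Finset.mem_univ k)
  have hpos : ∀ k ∈ T, 0 < p k := fun k hk =>
    lt_of_le_of_ne (hp k) (Finset.mem_filter.1 hk).2.symm
  have hsT : ∑ k ∈ T, p k = 1 := by rw [← hsum, hT, Finset.sum_filter_ne_zero]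
  have hlT : ∑ k ∈ T, p k * Real.log (p k) ^ 2 = ∑ k, p k * Real.log (p k) ^ 2 := by
    refine Finset.sum_subset (Finset.subset_univ _) fun k _ hk => ?_
    have : p k = 0 := by simpa [hT] using hk
    simp [this]
  rw [← hlT]
  have hcT : (T.card : ℝ) ≤ d := by exact_mod_cast hcard
  rcases Nat.lt_or_ge d 2 with h | h
  -- A single atom has probability one, hence no surprisal.
  · have hc1 : T.card ≤ 1 := by omega
    refine le_trans (le_of_eq (Finset.sum_eq_zero fun k hk => ?_)) (sq_nonneg _)
    have : T = {k} := by
      refine (Finset.eq_of_subset_of_card_le (Finset.singleton_subset_iff.2 hk) ?_).symm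
      simpa using hc1
    rw [this, Finset.sum_singleton] at hsT
    simp [hsT]
  rcases Nat.lt_or_ge d 3 with h3 | h3
  -- Here ln d < 1, so `mul_log_sq_le` is not available; two atoms give at most 6/5 < (2 ln 2)².
  · have hd2 : d = 2 := by omega
    subst hd2
    have h1 : ∑ k ∈ T, p k * Real.log (p k) ^ 2 ≤ T.card • (3 / 5 : ℝ) :=
      Finset.sum_le_card_nsmul _ _ _ fun k hk => mul_log_sq_le_const (hpos k hk) (hle k)
    rw [nsmul_eq_mul] at h1
    have h2 := Real.log_two_gt_d9
    push_cast at hcT ⊢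
    nlinarith
  -- Summing over the atoms gives (ln d)² + 2 ln d, at most 4 (ln d)² since ln d ≥ 1.
  · have h3' : (3 : ℝ) ≤ d := by exact_mod_cast h3
    have hl : 1 ≤ Real.log d := by
      rw [Real.le_log_iff_exp_le (by linarith)]
      linarith [Real.exp_one_lt_d9]
    have h1 : ∑ k ∈ T, p k * Real.log (p k) ^ 2
        ≤ ∑ k ∈ T, (p k * Real.log d ^ 2 + 2 * Real.log d / d) :=
      Finset.sum_le_sum fun k hk => mul_log_sq_le (hpos k hk) (hle k) h3'
    rw [Finset.sum_add_distrib, ← Finset.sum_mul, hsT, Finset.sum_const, nsmul_eq_mul] at h1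
    have h4 : (T.card : ℝ) * (2 * Real.log d / d) ≤ 2 * Real.log d := by
      rw [mul_div_assoc', div_le_iff₀ (by linarith), mul_comm]
      gcongr
    nlinarith

end Surprisal

/-! ### Schmidt decomposition. -/

section Schmidt

variable {A B : Type*} [Fintype A] [DecidableEq A] [Fintype B] [DecidableEq B]

/-- Coefficients on `A × B` whose support is a partial matching. -/
structure IsSchmidt (m : A × B → ℝ) : Prop where
  nonneg : ∀ k, 0 ≤ m k
  fst_unique : ∀ i i' j, m (i, j) ≠ 0 → m (i', j) ≠ 0 → i = i'
  snd_unique : ∀ i j j', m (i, j) ≠ 0 → m (i, j') ≠ 0 → j = j'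

/-- Both projections are injective on a partial matching. This is how d = min(d_A, d_B) enters. -/
lemma IsSchmidt.card_support_le {m : A × B → ℝ} (hm : IsSchmidt m) :
    (Finset.univ.filter fun k => m k ≠ 0).card ≤ min (Fintype.card A) (Fintype.card B) := by
  refine le_min ?_ ?_
  · refine Finset.card_le_card_of_injOn Prod.fst (fun _ _ => Finset.mem_univ _) ?_
    rintro ⟨i, j⟩ h ⟨i', j'⟩ h' (rfl : i = i')
    rw [hm.snd_unique i j j' (by simpa using h) (by simpa using h')]
  · refine Finset.card_le_card_of_injOn Prod.snd (fun _ _ => Finset.mem_univ _) ?_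
    rintro ⟨i, j⟩ h ⟨i', j'⟩ h' (rfl : j = j')
    rw [hm.fst_unique i i' j (by simpa using h) (by simpa using h')]

/-- The Schmidt decomposition. -/
lemma exists_schmidt (Ψ : A × B → ℂ) :
    ∃ U ∈ Matrix.unitaryGroup A ℂ, ∃ V ∈ Matrix.unitaryGroup B ℂ, ∃ m : A × B → ℝ,
      IsSchmidt m ∧ Ψ = (U ⊗ₖ V) *ᵥ (fun k => (m k : ℂ)) := by
  classical
  let M : Matrix A B ℂ := Matrix.of fun i j => Ψ (i, j)
  have hH : (M * Mᴴ).IsHermitian := Matrix.isHermitian_mul_conjTranspose_self M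
  obtain ⟨U, hU, hspec⟩ := exists_spectralMatrix hH
  have hnn : ∀ i, 0 ≤ hH.eigenvalues i :=
    (Matrix.posSemidef_self_mul_conjTranspose M).eigenvalues_nonneg
  generalize hH.eigenvalues = l at hspec hnn
  have hUU : Uᴴ * U = 1 := Matrix.mem_unitaryGroup_iff'.1 hU
  have hUU' : U * Uᴴ = 1 := Matrix.mem_unitaryGroup_iff.1 hU
  -- Singular value decomposition: the rows of `N` are pairwise orthogonal with squared norms `l`,
  -- and the normalised nonzero rows become columns of `V`.
  let N := Uᴴ * M
  have hM : M = U * N := by simp only [N]; rw [← Matrix.mul_assoc, hUU', Matrix.one_mul]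
  have hN : N * Nᴴ = Matrix.diagonal (fun k => (l k : ℂ)) := by
    calc N * Nᴴ = Uᴴ * (M * Mᴴ) * U := by
          simp only [N, Matrix.conjTranspose_mul, Matrix.conjTranspose_conjTranspose,
            Matrix.mul_assoc]
      _ = (Uᴴ * U) * Matrix.diagonal (fun k => (l k : ℂ)) * (Uᴴ * U) := by
          rw [hspec, spectralMatrix]; simp only [Matrix.mul_assoc]
      _ = _ := by rw [hUU]; simp
  let w : A → EuclideanSpace ℂ B := fun i => WithLp.toLp 2 (N i)
  have hw : ∀ i i', inner ℂ (w i) (w i') = if i = i' then (l i : ℂ) else 0 := by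
    intro i i'
    have h := congrFun (congrFun hN i') i
    rw [Matrix.mul_apply, Matrix.diagonal_apply] at h
    simp only [w, EuclideanSpace.inner_eq_star_dotProduct, dotProduct]
    simp only [Pi.star_apply, Matrix.conjTranspose_apply] at h ⊢
    rw [h]
    by_cases hi : i = i'
    · subst hi; simp
    · simp [hi, Ne.symm hi]
  let T := {i : A // l i ≠ 0}
  let w' : T → EuclideanSpace ℂ B := fun i => ((Real.sqrt (l i))⁻¹ : ℂ) • w i
  have hw' : Orthonormal ℂ w' := by
    rw [orthonormal_iff_ite]
    intro i i'
    simp only [w', inner_smul_left, inner_smul_right, hw]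
    by_cases hi : i = i'
    · subst hi
      have h0 : (Real.sqrt (l i)) ≠ 0 := (Real.sqrt_pos.2 (lt_of_le_of_ne (hnn i) i.2.symm)).ne'
      have h1 : ((Real.sqrt (l i) : ℝ) : ℂ) ≠ 0 := by exact_mod_cast h0
      have h2 : ((l i : ℝ) : ℂ) = (Real.sqrt (l i) : ℂ) * (Real.sqrt (l i) : ℂ) := by
        rw [← Complex.ofReal_mul, Real.mul_self_sqrt (hnn i)]
      simp only [if_true]
      rw [map_inv₀, Complex.conj_ofReal]
      conv_lhs => rw [h2]
      field_simp
    · have : (i : A) ≠ i' := fun h => hi (Subtype.ext h)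
      simp [hi, this]
  have hcard : Fintype.card T ≤ Fintype.card B := by
    have := hw'.linearIndependent.fintype_card_le_finrank
    simpa using this
  -- `A` and `B` share no indexing, so an arbitrary embedding pairs the nonzero singular values with
  -- elements of `B`; hence a partial matching rather than a diagonal.
  obtain ⟨g⟩ := Function.Embedding.nonempty_of_card_le hcard
  let v : B → EuclideanSpace ℂ B := Function.extend g w' 0
  have hvg : ∀ i, v (g i) = w' i := fun i => g.injective.extend_apply _ _ _
  have hv : Orthonormal ℂ ((Set.range g).domRestrict v) := by
    have : (Set.range g).domRestrict v = w' ∘ (Equiv.ofInjective g g.injective).symm := by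
      rw [Equiv.eq_comp_symm]
      ext1 i; simp [hvg]
    rw [this]
    exact hw'.comp _ (Equiv.injective _)
  obtain ⟨b, hb⟩ := hv.exists_orthonormalBasis_extension_of_card_eq (by simp)
  have hb' : ∀ i, b (g i) = w' i := fun i => by rw [hb _ ⟨i, rfl⟩, hvg]
  let V : Matrix B B ℂ := Matrix.of fun a j => b j a
  have hV : V ∈ Matrix.unitaryGroup B ℂ := by
    rw [Matrix.mem_unitaryGroup_iff']
    ext i j
    rw [Matrix.mul_apply, Matrix.one_apply]
    have := orthonormal_iff_ite.1 b.orthonormal i j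
    rw [EuclideanSpace.inner_eq_star_dotProduct, dotProduct] at this
    rw [← this]
    refine Finset.sum_congr rfl fun a _ => ?_
    simp [V, Matrix.star_apply, mul_comm]
  let m : A × B → ℝ := fun k => if h : l k.1 ≠ 0 then
    (if g ⟨k.1, h⟩ = k.2 then Real.sqrt (l k.1) else 0) else 0
  have hm0 : ∀ i j, m (i, j) ≠ 0 → ∃ h : l i ≠ 0, g ⟨i, h⟩ = j := by
    intro i j hne
    by_cases h : l i ≠ 0
    · refine ⟨h, ?_⟩
      by_contra h'
      exact hne (by simp [m, h'])
    · exact absurd (by simp only [m, h, dite_false]) hne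
  refine ⟨U, hU, V, hV, m, ⟨?_, ?_, ?_⟩, ?_⟩
  · intro k
    simp only [m]
    split_ifs <;> positivity
  · intro i i' j h h'
    obtain ⟨h1, h2⟩ := hm0 _ _ h
    obtain ⟨h1', h2'⟩ := hm0 _ _ h'
    exact congrArg Subtype.val (g.injective (h2.trans h2'.symm))
  · intro i j j' h h'
    obtain ⟨h1, h2⟩ := hm0 _ _ h
    obtain ⟨h1', h2'⟩ := hm0 _ _ h'
    exact h2.symm.trans h2'
  · have hrow : ∀ i a, N i a = ∑ j, V a j * (m (i, j) : ℂ) := by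
      intro i a
      by_cases h : l i ≠ 0
      · rw [Finset.sum_eq_single (g ⟨i, h⟩)]
        · have h0 : ((Real.sqrt (l i) : ℝ) : ℂ) ≠ 0 := by
            exact_mod_cast (Real.sqrt_pos.2 (lt_of_le_of_ne (hnn i) h.symm)).ne'
          simp [V, m, h, hb', w', w]
          field_simp
        · intro j _ hj
          simp [m, h, Ne.symm hj]
        · simp
      · have hz : w i = 0 := by
          rw [← inner_self_eq_zero (𝕜 := ℂ), hw]
          simpa using h
        have : N i a = 0 := by
          have := congrArg (fun f : EuclideanSpace ℂ B => f a) hz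
          simpa [w] using this
        rw [this, Finset.sum_eq_zero]
        intro j _
        simp only [m, h, dite_false]; simp
    ext ⟨a, c⟩
    have h1 : Ψ (a, c) = M a c := rfl
    rw [h1, hM, Matrix.mul_apply, Matrix.mulVec, dotProduct, Fintype.sum_prod_type]
    refine Finset.sum_congr rfl fun i _ => ?_
    rw [hrow, Finset.mul_sum]
    refine Finset.sum_congr rfl fun j _ => ?_
    rw [Matrix.kroneckerMap_apply]; ring

end Schmidt
end EntRate

namespace EntRate

/-! ### Calculus of matrices with a given eigenbasis. -/

section Spectral

variable {n : Type*} [Fintype n] [DecidableEq n]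

lemma spectralMatrix_add (U : Matrix n n ℂ) (s t : n → ℝ) :
    spectralMatrix U (s + t) = spectralMatrix U s + spectralMatrix U t := by
  simp only [spectralMatrix, Pi.add_apply, Complex.ofReal_add, ← Matrix.diagonal_add,
    Matrix.mul_add, Matrix.add_mul]

lemma spectralMatrix_smul (U : Matrix n n ℂ) (c : ℝ) (s : n → ℝ) :
    spectralMatrix U (c • s) = c • spectralMatrix U s := by
  have : (Matrix.diagonal fun k => (((c • s) k : ℝ) : ℂ))
      = c • Matrix.diagonal fun k => (s k : ℂ) := by
    ext i j
    by_cases h : i = j <;> simp [h]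
  simp only [spectralMatrix, this, Matrix.mul_smul, Matrix.smul_mul]

lemma spectralMatrix_mul {U : Matrix n n ℂ} (hU : U ∈ Matrix.unitaryGroup n ℂ) (s t : n → ℝ) :
    spectralMatrix U s * spectralMatrix U t = spectralMatrix U (s * t) :=
  (map_mul (spectralAlgHom hU) s t).symm

lemma spectralMatrix_sum {U : Matrix n n ℂ} (hU : U ∈ Matrix.unitaryGroup n ℂ) (s : n → ℝ) :
    spectralMatrix U s = ∑ k, s k • spectralMatrix U (Pi.single k 1) := by
  have h : s = ∑ k, s k • Pi.single k (1 : ℝ) := by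
    ext j
    simp [Finset.sum_apply, Pi.single_apply]
  have h2 := congrArg (spectralAlgHom hU) h
  rw [map_sum] at h2
  simp only [map_smul] at h2
  exact h2

lemma trace_spectralMatrix {U : Matrix n n ℂ} (hU : U ∈ Matrix.unitaryGroup n ℂ) (s : n → ℝ) :
    (spectralMatrix U s).trace = ((∑ k, s k : ℝ) : ℂ) := by
  have := Matrix.mem_unitaryGroup_iff'.1 hU
  rw [Matrix.star_eq_conjTranspose] at this
  rw [spectralMatrix, Matrix.trace_mul_comm, ← Matrix.mul_assoc, this, Matrix.one_mul,
    Matrix.trace_diagonal, Complex.ofReal_sum]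

lemma posSemidef_spectralMatrix (U : Matrix n n ℂ) {s : n → ℝ} (hs : ∀ k, 0 ≤ s k) :
    (spectralMatrix U s).PosSemidef := by
  refine Matrix.PosSemidef.mul_mul_conjTranspose_same ?_ U
  rw [Matrix.posSemidef_diagonal_iff]
  intro k
  exact_mod_cast hs k

lemma posDef_spectralMatrix {U : Matrix n n ℂ} (hU : U ∈ Matrix.unitaryGroup n ℂ) {s : n → ℝ}
    (hs : ∀ k, 0 < s k) : (spectralMatrix U s).PosDef := by
  refine Matrix.PosDef.mul_mul_conjTranspose_same ?_ ?_
  · rw [Matrix.posDef_diagonal_iff]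
    intro k
    exact_mod_cast hs k
  · have : IsUnit U := ⟨Unitary.toUnits ⟨U, hU⟩, rfl⟩
    exact Matrix.vecMul_injective_of_isUnit this

/-- A unitary preserves the sum of the squared moduli. -/
lemma sum_norm_sq_conjTranspose_mulVec {U : Matrix n n ℂ} (hU : U ∈ Matrix.unitaryGroup n ℂ)
    (v : n → ℂ) : ∑ k, ‖(Uᴴ *ᵥ v) k‖ ^ 2 = ∑ k, ‖v k‖ ^ 2 := by
  have h1 : (1 : Matrix n n ℂ) = spectralMatrix U 1 := (map_one (spectralAlgHom hU)).symm
  have := quadForm_spectralMatrix U 1 v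
  rw [← h1, quadForm_one] at this
  simpa using this.symm

/-- `Zᵀ k` is the `k`-th column of `Z`; for unitary `Z` it is the eigenvector belonging to `p k`. -/
lemma re_trace_spectralMatrix_mul (Z : Matrix n n ℂ) (p : n → ℝ) (X : Matrix n n ℂ) :
    (spectralMatrix Z p * X).trace.re = ∑ k, p k * quadForm X (Zᵀ k) := by
  have h : (spectralMatrix Z p * X).trace
      = (Matrix.diagonal (fun k => (p k : ℂ)) * (Zᴴ * X * Z)).trace := by
    rw [spectralMatrix, Matrix.mul_assoc, Matrix.mul_assoc, Matrix.trace_mul_comm]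
    simp only [Matrix.mul_assoc]
  rw [h, Matrix.trace, Complex.re_sum]
  refine Finset.sum_congr rfl fun k _ => ?_
  rw [Matrix.diag_apply, Matrix.diagonal_mul, Complex.re_ofReal_mul]
  congr 1
  rw [quadForm, Matrix.mul_assoc, Matrix.mul_apply]
  rfl

lemma quadForm_log_smul {X : Matrix n n ℂ} (hX : X.PosDef) {c : ℝ} (hc : 0 < c) (v : n → ℂ) :
    quadForm (cfc Real.log (c • X)) v
      = Real.log c * quadForm 1 v + quadForm (cfc Real.log X) v := by
  obtain ⟨U, hU, h⟩ := exists_spectralMatrix hX.1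
  have hpos := hX.eigenvalues_pos
  generalize hX.1.eigenvalues = s at h hpos
  have h1 : (1 : Matrix n n ℂ) = spectralMatrix U 1 := (map_one (spectralAlgHom hU)).symm
  rw [h, ← spectralMatrix_smul, cfc_spectralMatrix _ hU, cfc_spectralMatrix _ hU, h1,
    ← quadForm_smul, ← quadForm_add, ← spectralMatrix_smul, ← spectralMatrix_add]
  congr 2
  ext k
  simp [Real.log_mul hc.ne' (hpos k).ne']

lemma quadForm_one_col {Z : Matrix n n ℂ} (hZ : Z ∈ Matrix.unitaryGroup n ℂ) (k : n) :
    quadForm 1 (Zᵀ k) = 1 := by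
  have := congrFun (congrFun (Matrix.mem_unitaryGroup_iff'.1 hZ) k) k
  rw [Matrix.mul_apply, Matrix.one_apply_eq] at this
  rw [quadForm, Matrix.one_mulVec, dotProduct]
  have h2 : ∑ i, star (Zᵀ k) i * Zᵀ k i = 1 := by rw [← this]; rfl
  rw [h2]; rfl

end Spectral

/-! ### Separable trial states and upper bounds on the entanglement. -/

section Separable

variable {A B : Type*} [Fintype A] [DecidableEq A] [Fintype B] [DecidableEq B]

/-- The eigenprojections in a product basis are product states, and `s` gives their convex weights.
-/
lemma spectralMatrix_mem_separableStates {U : Matrix A A ℂ} {V : Matrix B B ℂ}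
    (hU : U ∈ Matrix.unitaryGroup A ℂ) (hV : V ∈ Matrix.unitaryGroup B ℂ) {s : A × B → ℝ}
    (hs : ∀ k, 0 ≤ s k) (hs1 : ∑ k, s k = 1) :
    spectralMatrix (U ⊗ₖ V) s ∈ separableStates A B := by
  rw [spectralMatrix_sum (kronecker_mem_unitaryGroup hU hV)]
  refine (convex_convexHull ℝ _).sum_mem (fun k _ => hs k) hs1 fun k _ => ?_
  refine subset_convexHull ℝ _ ⟨spectralMatrix U (Pi.single k.1 1),
    spectralMatrix V (Pi.single k.2 1), ⟨posSemidef_spectralMatrix _ ?_, ?_⟩,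
    ⟨posSemidef_spectralMatrix _ ?_, ?_⟩, ?_⟩
  · exact fun i => by rw [Pi.single_apply]; split_ifs <;> simp
  · rw [trace_spectralMatrix hU]; simp
  · exact fun i => by rw [Pi.single_apply]; split_ifs <;> simp
  · rw [trace_spectralMatrix hV]; simp
  · rw [spectralMatrix_kronecker]
    congr 1
    ext ⟨i, j⟩
    obtain ⟨i', j'⟩ := k
    simp only [Pi.single_apply, Prod.mk.injEq]
    by_cases h1 : i = i' <;> by_cases h2 : j = j' <;> simp [h1, h2]

/-- The entropy of the squared Schmidt coefficients. -/
noncomputable def schmidtEntropy (m : A × B → ℝ) : ℝ := ∑ k, Real.negMulLog (m k ^ 2)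

lemma neg_log_sq_nonneg {m : A × B → ℝ} (hm1 : ∑ k, m k ^ 2 = 1) (k : A × B) :
    0 ≤ -Real.log (m k ^ 2) := by
  have : m k ^ 2 ≤ 1 := by
    rw [← hm1]; exact Finset.single_le_sum (fun i _ => sq_nonneg (m i)) (Finset.mem_univ k)
  linarith [Real.log_nonpos (sq_nonneg (m k)) this]

lemma schmidtEntropy_nonneg {m : A × B → ℝ} (hm1 : ∑ k, m k ^ 2 = 1) : 0 ≤ schmidtEntropy m := by
  refine Finset.sum_nonneg fun k _ => ?_
  have := neg_log_sq_nonneg hm1 k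
  rw [Real.negMulLog]
  nlinarith [sq_nonneg (m k)]

/-- Cauchy-Schwarz: the squared length of m·(-ln m²) is the second moment of the surprisal. Taking
`f` to be a perturbation controls the first-order change of the entropy; taking `f = m` bounds the
entropy itself, losing a harmless factor 2. -/
lemma IsSchmidt.sum_mul_neg_log_le {m : A × B → ℝ} (hm : IsSchmidt m) (hm1 : ∑ k, m k ^ 2 = 1)
    {f : A × B → ℝ} {η : ℝ} (hη : 0 ≤ η) (hf : ∑ k, f k ^ 2 ≤ η ^ 2) :
    ∑ k, f k * (m k * -Real.log (m k ^ 2))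
      ≤ η * (2 * Real.log (min (Fintype.card A) (Fintype.card B) : ℕ)) := by
  set d := min (Fintype.card A) (Fintype.card B)
  have h1 : ∑ k, (m k * -Real.log (m k ^ 2)) ^ 2 ≤ (2 * Real.log d) ^ 2 := by
    refine le_trans (le_of_eq ?_) (sum_mul_log_sq_le (p := fun k => m k ^ 2)
      (fun k => sq_nonneg _) hm1 (d := d) ?_)
    · exact Finset.sum_congr rfl fun k _ => by ring
    · simpa [d] using hm.card_support_le
  have h0 : 0 ≤ 2 * Real.log d := by
    have := Real.log_natCast_nonneg d
    positivity
  refine (Real.sum_mul_le_sqrt_mul_sqrt _ _ _).trans ?_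
  gcongr
  · exact Real.sqrt_le_iff.2 ⟨hη, hf⟩
  · exact Real.sqrt_le_iff.2 ⟨h0, h1⟩

lemma IsSchmidt.schmidtEntropy_le {m : A × B → ℝ} (hm : IsSchmidt m) (hm1 : ∑ k, m k ^ 2 = 1) :
    schmidtEntropy m ≤ 2 * Real.log (min (Fintype.card A) (Fintype.card B) : ℕ) := by
  have := hm.sum_mul_neg_log_le hm1 (f := m) zero_le_one (by rw [hm1]; norm_num)
  rw [one_mul] at this
  refine le_trans (le_of_eq (Finset.sum_congr rfl fun k _ => ?_)) this
  rw [Real.negMulLog]; ring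

/-- The separable state attached to a Schmidt decomposition, mixed with white noise of weight
`x`. -/
noncomputable def schmidtState (U : Matrix A A ℂ) (V : Matrix B B ℂ) (m : A × B → ℝ) (x : ℝ) :
    Matrix (A × B) (A × B) ℂ :=
  spectralMatrix (U ⊗ₖ V) fun k => (1 - x) * m k ^ 2 + x / Fintype.card (A × B)

section

variable {U : Matrix A A ℂ} {V : Matrix B B ℂ} (hU : U ∈ Matrix.unitaryGroup A ℂ)
  (hV : V ∈ Matrix.unitaryGroup B ℂ) {m : A × B → ℝ} (hm : IsSchmidt m)
  (hm1 : ∑ k, m k ^ 2 = 1) {x : ℝ} (hx0 : 0 < x) (hx1 : x < 1)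

include hm1

lemma card_pos_of_sum_sq : 0 < (Fintype.card (A × B) : ℝ) := by
  have : Nonempty (A × B) := by
    by_contra h
    rw [not_nonempty_iff] at h
    simp at hm1
  exact_mod_cast Fintype.card_pos

include hx0 hx1

lemma schmidtWeight_pos (k : A × B) : 0 < (1 - x) * m k ^ 2 + x / Fintype.card (A × B) := by
  have := card_pos_of_sum_sq hm1
  have h1 : 0 < 1 - x := by linarith
  positivity

lemma sum_schmidtWeight : ∑ k, ((1 - x) * m k ^ 2 + x / Fintype.card (A × B)) = 1 := by
  have := card_pos_of_sum_sq hm1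
  rw [Finset.sum_add_distrib, ← Finset.mul_sum, hm1, Finset.sum_const, nsmul_eq_mul,
    Finset.card_univ, mul_div_cancel₀ _ this.ne']
  ring

include hU hV

lemma schmidtState_mem : schmidtState U V m x ∈ separableStates A B :=
  spectralMatrix_mem_separableStates hU hV (fun k => (schmidtWeight_pos hm1 hx0 hx1 k).le)
    (sum_schmidtWeight hm1 hx0 hx1)

lemma schmidtState_posDef : (schmidtState U V m x).PosDef :=
  posDef_spectralMatrix (kronecker_mem_unitaryGroup hU hV) (schmidtWeight_pos hm1 hx0 hx1)

include hm

/-- In the Schmidt basis the logarithm is diagonal, and |m + e'|² ≤ m² + 2m|e'| + |e'|². The first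
two terms live on the support of `m`, where the weight is at least (1 - x) m². The last may leave
the support and relies on the noise floor x/N; it is quadratic in η, so ln(N/x) is affordable. -/
lemma neg_quadForm_log_schmidtState_le {e : A × B → ℂ} {η : ℝ} (hη : 0 ≤ η)
    (he : ∑ k, ‖e k‖ ^ 2 ≤ η ^ 2) :
    -quadForm (cfc Real.log (schmidtState U V m x)) ((U ⊗ₖ V) *ᵥ (fun k => (m k : ℂ)) + e)
      ≤ schmidtEntropy m - Real.log (1 - x)
        + 2 * η * (2 * Real.log (min (Fintype.card A) (Fintype.card B) : ℕ) - Real.log (1 - x))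
        + η ^ 2 * Real.log (Fintype.card (A × B) / x) := by
  have hW := kronecker_mem_unitaryGroup hU hV
  set W := U ⊗ₖ V
  have hN := card_pos_of_sum_sq hm1
  set N : ℝ := (Fintype.card (A × B) : ℝ)
  have hWW : Wᴴ * W = 1 := Matrix.mem_unitaryGroup_iff'.1 hW
  set y := -Real.log (1 - x) with hy
  have hy0 : 0 ≤ y := by
    have := Real.log_nonpos (by linarith : 0 ≤ 1 - x) (by linarith); linarith
  set e' := Wᴴ *ᵥ e
  have he' : ∑ k, ‖e' k‖ ^ 2 ≤ η ^ 2 := by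
    rw [sum_norm_sq_conjTranspose_mulVec hW]; exact he
  have hvec : Wᴴ *ᵥ (W *ᵥ (fun k => (m k : ℂ)) + e) = fun k => (m k : ℂ) + e' k := by
    rw [Matrix.mulVec_add, Matrix.mulVec_mulVec, hWW, Matrix.one_mulVec]; rfl
  set s : A × B → ℝ := fun k => (1 - x) * m k ^ 2 + x / N with hs
  have hspos : ∀ k, 0 < s k := schmidtWeight_pos hm1 hx0 hx1
  have hs1 : ∀ k, s k ≤ 1 := fun k => by
    rw [← sum_schmidtWeight hm1 hx0 hx1]
    exact Finset.single_le_sum (f := s) (fun i _ => (hspos i).le) (Finset.mem_univ k)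
  have hg0 : ∀ k, 0 ≤ -Real.log (s k) := fun k => by
    linarith [Real.log_nonpos (hspos k).le (hs1 k)]
  have hgN : ∀ k, -Real.log (s k) ≤ Real.log (N / x) := fun k => by
    rw [← Real.log_inv]
    apply Real.log_le_log (inv_pos.2 (hspos k))
    rw [← inv_div]
    apply inv_anti₀ (by positivity)
    have : 0 ≤ (1 - x) * m k ^ 2 := mul_nonneg (by linarith) (sq_nonneg _)
    simp only [hs]; linarith
  have hgm : ∀ k, m k ≠ 0 → -Real.log (s k) ≤ y + -Real.log (m k ^ 2) := fun k hk => by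
    have h1 : 0 < 1 - x := by linarith
    have h2 : 0 < m k ^ 2 := by positivity
    have h3 : Real.log ((1 - x) * m k ^ 2) ≤ Real.log (s k) := by
      apply Real.log_le_log (by positivity)
      have : 0 ≤ x / N := by positivity
      simp only [hs]; linarith
    rw [Real.log_mul h1.ne' h2.ne'] at h3
    linarith
  have hterm : ∀ k, -(Real.log (s k) * ‖(m k : ℂ) + e' k‖ ^ 2)
      ≤ (Real.negMulLog (m k ^ 2) + y * m k ^ 2)
        + 2 * (y * (‖e' k‖ * m k) + ‖e' k‖ * (m k * -Real.log (m k ^ 2)))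
        + ‖e' k‖ ^ 2 * Real.log (N / x) := by
    intro k
    have hmk := hm.nonneg k
    have h1 : ‖(m k : ℂ) + e' k‖ ≤ m k + ‖e' k‖ := by
      refine (norm_add_le _ _).trans ?_
      rw [Complex.norm_real, Real.norm_of_nonneg hmk]
    have h2 : ‖(m k : ℂ) + e' k‖ ^ 2 ≤ m k ^ 2 + 2 * m k * ‖e' k‖ + ‖e' k‖ ^ 2 := by
      have := pow_le_pow_left₀ (norm_nonneg _) h1 2
      linarith [this]
    have h3 : -(Real.log (s k) * ‖(m k : ℂ) + e' k‖ ^ 2)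
        ≤ -Real.log (s k) * (m k ^ 2 + 2 * m k * ‖e' k‖ + ‖e' k‖ ^ 2) := by
      rw [← neg_mul]; exact mul_le_mul_of_nonneg_left h2 (hg0 k)
    have h4 : -Real.log (s k) * ‖e' k‖ ^ 2 ≤ ‖e' k‖ ^ 2 * Real.log (N / x) := by
      rw [mul_comm]; exact mul_le_mul_of_nonneg_left (hgN k) (sq_nonneg _)
    have h5 : -Real.log (s k) * (m k ^ 2 + 2 * m k * ‖e' k‖)
        ≤ (y + -Real.log (m k ^ 2)) * (m k ^ 2 + 2 * m k * ‖e' k‖) := by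
      by_cases h : m k = 0
      · simp [h]
      · exact mul_le_mul_of_nonneg_right (hgm k h) (by positivity)
    rw [Real.negMulLog]
    linarith
  have hc1 : ∑ k, ‖e' k‖ * m k ≤ η := by
    have h1 := Real.sum_mul_le_sqrt_mul_sqrt Finset.univ (fun k => ‖e' k‖) m
    rw [hm1, Real.sqrt_one, mul_one] at h1
    exact h1.trans (Real.sqrt_le_iff.2 ⟨hη, he'⟩)
  have hc2 := hm.sum_mul_neg_log_le hm1 hη he'
  have hlog : 0 ≤ Real.log (N / x) := by
    obtain ⟨k⟩ : Nonempty (A × B) := Fintype.card_pos_iff.1 (Nat.cast_pos.1 hN)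
    exact (hg0 k).trans (hgN k)
  rw [schmidtState, cfc_spectralMatrix _ hW, quadForm_spectralMatrix, hvec,
    ← Finset.sum_neg_distrib]
  refine (Finset.sum_le_sum fun k _ => hterm k).trans ?_
  rw [Finset.sum_add_distrib, Finset.sum_add_distrib, Finset.sum_add_distrib, ← Finset.mul_sum,
    ← Finset.mul_sum, Finset.sum_add_distrib, ← Finset.mul_sum, ← Finset.sum_mul, hm1]
  have h6 := mul_le_mul_of_nonneg_left hc1 hy0
  have h7 := mul_le_mul_of_nonneg_right he' hlog
  change schmidtEntropy m + _ + _ + _ ≤ _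
  linarith

end

/-- The relative entropy of entanglement of a mixture of orthogonal pure states is at most the
mean of the relative entropies to arbitrary separable states. -/
lemma relEntropyEntanglement_le_sum {Z : Matrix (A × B) (A × B) ℂ}
    (hZ : Z ∈ Matrix.unitaryGroup (A × B) ℂ) {p : A × B → ℝ} (hp : ∀ k, 0 ≤ p k)
    (hp1 : ∑ k, p k = 1) {σ : A × B → Matrix (A × B) (A × B) ℂ}
    (hσ : ∀ k, σ k ∈ separableStates A B) (hσp : ∀ k, (σ k).PosDef) {b : A × B → ℝ}
    (hb : ∀ k, -quadForm (cfc Real.log (σ k)) (Zᵀ k) ≤ b k) :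
    relEntropyEntanglement (spectralMatrix Z p) ≤ ((∑ k, p k * b k : ℝ) : EReal) := by
  -- From τ ≥ p_k σ_k follows ln τ ≥ ln p_k + ln σ_k. The resulting -p_k ln p_k cancels the entropy
  -- of the spectrum.
  set τ := ∑ k, p k • σ k with hτ
  have hτsep : τ ∈ separableStates A B :=
    (convex_convexHull ℝ _).sum_mem (fun k _ => hp k) hp1 fun k _ => hσ k
  have hle : ∀ k, p k • σ k ≤ τ := fun k =>
    Finset.single_le_sum (f := fun k => p k • σ k)
      (fun i _ => Matrix.nonneg_iff_posSemidef.2 ((hσp i).posSemidef.smul (hp i)))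
      (Finset.mem_univ k)
  obtain ⟨k0, -, hk0⟩ : ∃ k ∈ Finset.univ, 0 < p k := by
    by_contra! h
    have : ∑ k, p k ≤ 0 := Finset.sum_nonpos h
    linarith
  have hτp : τ.PosDef := by
    rw [← Matrix.isStrictlyPositive_iff_posDef]
    exact ((hσp k0).smul hk0).isStrictlyPositive.of_le (hle k0)
  refine (iInf₂_le τ hτsep).trans ?_
  have hker : LinearMap.ker (Matrix.toLin' τ) = ⊥ := by
    rw [LinearMap.ker_eq_bot]
    exact Matrix.mulVec_injective_of_isUnit hτp.isUnit
  rw [relEntropy, if_pos (by rw [hker]; exact bot_le), EReal.coe_le_coe_iff, Matrix.trace_sub,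
    Complex.sub_re, cfc_spectralMatrix _ hZ, spectralMatrix_mul hZ, trace_spectralMatrix hZ,
    Complex.ofReal_re, re_trace_spectralMatrix_mul, ← Finset.sum_sub_distrib]
  refine Finset.sum_le_sum fun k _ => ?_
  rcases (hp k).eq_or_lt with h | h
  · simp [← h]
  · have h1 := quadForm_log_mono ((hσp k).smul h) (hle k) (Zᵀ k)
    rw [quadForm_log_smul (hσp k) h, quadForm_one_col hZ, mul_one] at h1
    have h2 := hb k
    simp only [Pi.mul_apply, Function.comp_apply]
    rw [← mul_sub]
    exact mul_le_mul_of_nonneg_left (by linarith) h.le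

end Separable
end EntRate

namespace EntRate

/-! ### Pure states. -/

section Pure

variable {n : Type*} [Fintype n] [DecidableEq n]

lemma quadForm_mulVec (X W : Matrix n n ℂ) (v : n → ℂ) :
    quadForm X (W *ᵥ v) = quadForm (Wᴴ * X * W) v := by
  rw [quadForm, quadForm, Matrix.star_mulVec, ← Matrix.dotProduct_mulVec, Matrix.mulVec_mulVec,
    Matrix.mulVec_mulVec, Matrix.mul_assoc]

lemma star_dotProduct_self (v : n → ℂ) : star v ⬝ᵥ v = ((∑ k, ‖v k‖ ^ 2 : ℝ) : ℂ) := by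
  rw [dotProduct, Complex.ofReal_sum]
  refine Finset.sum_congr rfl fun k _ => ?_
  rw [Pi.star_apply, Complex.star_def, ← Complex.normSq_eq_conj_mul_self,
    Complex.normSq_eq_norm_sq]

lemma sum_quadForm_col {U : Matrix n n ℂ} (hU : U ∈ Matrix.unitaryGroup n ℂ)
    (X : Matrix n n ℂ) : ∑ k, quadForm X (Uᵀ k) = X.trace.re := by
  have h := re_trace_spectralMatrix_mul U 1 X
  rw [show spectralMatrix U 1 = 1 from map_one (spectralAlgHom hU), one_mul] at h
  simpa using h.symm

lemma trace_pureState_mul (Ψ : EuclideanSpace ℂ n) (X : Matrix n n ℂ) :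
    (pureState Ψ * X).trace.re = quadForm X Ψ := by
  rw [pureState, Matrix.vecMulVec_mul, Matrix.trace_vecMulVec, quadForm, Matrix.dotProduct_mulVec,
    dotProduct_comm]
  rfl

lemma sum_norm_sq_eq_one {Ψ : EuclideanSpace ℂ n} (hΨ : ‖Ψ‖ = 1) : ∑ k, ‖Ψ k‖ ^ 2 = 1 := by
  rw [← EuclideanSpace.norm_sq_eq, hΨ, one_pow]

lemma star_dotProduct_of_norm_eq_one {Ψ : EuclideanSpace ℂ n} (hΨ : ‖Ψ‖ = 1) :
    star (fun i => Ψ i) ⬝ᵥ (fun i => Ψ i) = 1 := by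
  rw [star_dotProduct_self, sum_norm_sq_eq_one hΨ, Complex.ofReal_one]

lemma pureState_mulVec (Ψ : EuclideanSpace ℂ n) (v : n → ℂ) :
    pureState Ψ *ᵥ v = (star (fun i => Ψ i) ⬝ᵥ v) • (fun i => Ψ i) := by
  rw [pureState, Matrix.vecMulVec_mulVec, op_smul_eq_smul]
  rfl

/-- A projection has spectrum in {0, 1}, and `Real.log` vanishes at both points. -/
lemma cfc_log_pureState {Ψ : EuclideanSpace ℂ n} (hΨ : ‖Ψ‖ = 1) :
    cfc Real.log (pureState Ψ) = 0 := by
  have hidem : IsIdempotentElem (pureState Ψ) := by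
    rw [IsIdempotentElem]
    conv_lhs => rw [pureState, Matrix.vecMulVec_mul_vecMulVec]
    have := star_dotProduct_of_norm_eq_one hΨ
    rw [show (fun i => star (Ψ i)) ⬝ᵥ (fun i => Ψ i) = 1 from this]
    simp [pureState]
  rw [show (0 : Matrix n n ℂ) = cfc (fun _ => (0 : ℝ)) (pureState Ψ) from
    (cfc_const_zero ℝ _).symm]
  refine cfc_congr fun x hx => ?_
  have := hidem.spectrum_subset ℝ hx
  rcases this with rfl | rfl <;> simp

end Pure

/-! ### Lower bound for pure states through the reduction criterion. -/

section Separable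

variable {A B : Type*} [Fintype A] [DecidableEq A] [Fintype B] [DecidableEq B]

lemma IsState.le_one {σ : Matrix A A ℂ} (hσ : IsState σ) : σ ≤ 1 := by
  obtain ⟨U, hU, h⟩ := exists_spectralMatrix hσ.1.1
  have hnn := hσ.1.eigenvalues_nonneg
  generalize hσ.1.1.eigenvalues = s at h hnn
  have htr : ∑ k, s k = 1 := by
    have := hσ.2
    rw [h, trace_spectralMatrix hU] at this
    exact_mod_cast this
  rw [Matrix.le_iff]
  have h1 : 1 - σ = spectralMatrix U (1 - s) := by
    rw [h]
    exact ((map_sub (spectralAlgHom hU) 1 s).trans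
      (by rw [map_one]; rfl)).symm
  rw [h1]
  refine posSemidef_spectralMatrix U fun k => ?_
  have : s k ≤ 1 := by
    rw [← htr]; exact Finset.single_le_sum (fun i _ => hnn i) (Finset.mem_univ k)
  simpa using this

/-- The reduction criterion: a separable state is dominated by `τ ⊗ 1` for a state `τ`. -/
lemma exists_le_kronecker_one {σ : Matrix (A × B) (A × B) ℂ} (hσ : σ ∈ separableStates A B) :
    σ.PosSemidef ∧ ∃ τ : Matrix A A ℂ, τ.PosSemidef ∧ τ.trace = 1 ∧
      σ ≤ τ ⊗ₖ (1 : Matrix B B ℂ) := by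
  have key : separableStates A B ⊆ {σ | 0 ≤ σ ∧ ∃ τ : Matrix A A ℂ, 0 ≤ τ ∧ τ.trace = 1 ∧
      σ ≤ τ ⊗ₖ (1 : Matrix B B ℂ)} := by
    -- The condition is convex, and for a product state σ_B ≤ 1 gives σ_A ⊗ σ_B ≤ σ_A ⊗ 1.
    refine convexHull_min ?_ ?_
    · rintro _ ⟨σA, σB, hA, hB, rfl⟩
      refine ⟨Matrix.nonneg_iff_posSemidef.2 (hA.1.kronecker hB.1), σA,
        Matrix.nonneg_iff_posSemidef.2 hA.1, hA.2, ?_⟩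
      have h1 : (1 - σB).PosSemidef := Matrix.le_iff.1 hB.le_one
      have h2 : σA ⊗ₖ (1 : Matrix B B ℂ) - σA ⊗ₖ σB = σA ⊗ₖ (1 - σB) := by
        ext i j
        simp [Matrix.kroneckerMap_apply, mul_sub]
      rw [Matrix.le_iff, h2]
      exact hA.1.kronecker h1
    · rintro σ ⟨h0, τ, hτ, hτ1, hle⟩ σ' ⟨h0', τ', hτ', hτ1', hle'⟩ a b ha hb hab
      have hsm : ∀ {k : Type _} [Fintype k] [DecidableEq k] {c : ℝ} {X : Matrix k k ℂ}, 0 ≤ c →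
          0 ≤ X → 0 ≤ c • X := fun hc hX =>
        Matrix.nonneg_iff_posSemidef.2 ((Matrix.nonneg_iff_posSemidef.1 hX).smul hc)
      have hsm' : ∀ {c : ℝ} {X : Matrix (A × B) (A × B) ℂ}, 0 ≤ c → 0 ≤ X → 0 ≤ c • X :=
        fun hc hX => Matrix.nonneg_iff_posSemidef.2 ((Matrix.nonneg_iff_posSemidef.1 hX).smul hc)
      refine ⟨add_nonneg (hsm' ha h0) (hsm' hb h0'), a • τ + b • τ',
        add_nonneg (hsm ha hτ) (hsm hb hτ'), ?_, ?_⟩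
      · rw [Matrix.trace_add, Matrix.trace_smul, Matrix.trace_smul, hτ1, hτ1']
        simp only [Complex.real_smul, mul_one]
        exact_mod_cast hab
      · have h3 := add_nonneg (hsm' ha (sub_nonneg.2 hle)) (hsm' hb (sub_nonneg.2 hle'))
        rw [← sub_nonneg]
        convert h3 using 1
        rw [Matrix.add_kronecker, Matrix.smul_kronecker, Matrix.smul_kronecker]
        simp only [smul_sub]
        abel
  obtain ⟨h0, τ, hτ, h1, h2⟩ := key hσ
  exact ⟨Matrix.nonneg_iff_posSemidef.1 h0, τ, Matrix.nonneg_iff_posSemidef.1 hτ, h1, h2⟩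

/-- Tracing out `B` leaves a state diagonal in the basis of columns of `U`: the matching kills the
cross terms. -/
lemma IsSchmidt.quadForm_kronecker_one {U : Matrix A A ℂ} {V : Matrix B B ℂ}
    (hV : V ∈ Matrix.unitaryGroup B ℂ) {m : A × B → ℝ} (hm : IsSchmidt m) (X : Matrix A A ℂ) :
    quadForm (X ⊗ₖ (1 : Matrix B B ℂ)) ((U ⊗ₖ V) *ᵥ (fun k => (m k : ℂ)))
      = ∑ k, m k ^ 2 * quadForm X (Uᵀ k.1) := by
  have hVV : Vᴴ * V = 1 := Matrix.mem_unitaryGroup_iff'.1 hV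
  rw [quadForm_mulVec, Matrix.conjTranspose_kronecker, ← Matrix.mul_kronecker_mul,
    ← Matrix.mul_kronecker_mul, Matrix.mul_one, hVV, quadForm, dotProduct, Complex.re_sum]
  refine Finset.sum_congr rfl fun k _ => ?_
  obtain ⟨i, j⟩ := k
  have hG : (Uᴴ * X * U) i i = star (Uᵀ i) ⬝ᵥ X *ᵥ (Uᵀ i) := by
    rw [Matrix.mul_assoc, Matrix.mul_apply]; rfl
  rw [Pi.star_apply, Complex.star_def, Complex.conj_ofReal, Complex.re_ofReal_mul]
  by_cases h0 : m (i, j) = 0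
  · simp [h0]
  have h1 : ((Uᴴ * X * U) ⊗ₖ (1 : Matrix B B ℂ) *ᵥ (fun k => (m k : ℂ))) (i, j)
      = (Uᴴ * X * U) i i * m (i, j) := by
    rw [Matrix.mulVec, dotProduct, Finset.sum_eq_single (i, j)]
    · simp [Matrix.kroneckerMap_apply]
    · rintro ⟨i', j'⟩ _ hne
      rw [Matrix.kroneckerMap_apply, Matrix.one_apply]
      by_cases hj : j = j'
      · subst hj
        have : m (i', j) = 0 := by
          by_contra h'
          exact hne (by rw [hm.fst_unique i' i j h' h0])
        simp [this]
      · simp [hj]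
    · simp
  rw [h1, mul_comm _ ((m (i, j) : ℂ)), Complex.re_ofReal_mul, hG, quadForm]
  ring

/-- Each `i` has at most one partner, so no diagonal entry is counted twice and a trace over `A`
bounds the sum. -/
lemma IsSchmidt.sum_support_le {m : A × B → ℝ} (hm : IsSchmidt m) {c : A → ℝ}
    (hc : ∀ i, 0 ≤ c i) : ∑ k, (if m k = 0 then 0 else c k.1) ≤ ∑ i, c i := by
  rw [Fintype.sum_prod_type]
  refine Finset.sum_le_sum fun i _ => ?_
  by_cases h : ∃ j, m (i, j) ≠ 0
  · obtain ⟨j, hj⟩ := h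
    rw [Finset.sum_eq_single j]
    · simp [hj]
    · intro j' _ hne
      by_contra h'
      have : m (i, j') ≠ 0 := fun h0 => h' (by simp [h0])
      exact hne (hm.snd_unique i j' j this hj)
    · simp
  · push Not at h
    simp [h, hc i]

/-- From σ ≤ τ ⊗ 1, ⟨ln σ⟩ ≤ ∑ m_k² ⟨u_k, ln τ u_k⟩. The tangent to the logarithm at m_k² bounds
this by ∑ (⟨u_k, τ u_k⟩ - m_k² + m_k² ln m_k²), over the support, which is at most tr τ - 1 minus
the entropy. Adding η to σ and τ makes them invertible and costs η dim A. -/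
lemma schmidtEntropy_le_neg_quadForm_log {U : Matrix A A ℂ} {V : Matrix B B ℂ}
    (hU : U ∈ Matrix.unitaryGroup A ℂ) (hV : V ∈ Matrix.unitaryGroup B ℂ) {m : A × B → ℝ}
    (hm : IsSchmidt m) (hm1 : ∑ k, m k ^ 2 = 1) {σ : Matrix (A × B) (A × B) ℂ}
    (hσ : σ ∈ separableStates A B) {v : A × B → ℂ}
    (hv : v = (U ⊗ₖ V) *ᵥ (fun k => (m k : ℂ)))
    (hker : ∀ w, σ *ᵥ w = 0 → star v ⬝ᵥ w = 0) :
    schmidtEntropy m ≤ -quadForm (cfc Real.log σ) v := by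
  obtain ⟨hσ0, τ, hτ0, hτ1, hle⟩ := exists_le_kronecker_one hσ
  obtain ⟨Y, hY, hspec⟩ := exists_spectralMatrix hσ0.1
  have hnn := hσ0.eigenvalues_nonneg
  generalize hσ0.1.eigenvalues = s at hspec hnn
  have hkey : ∀ η : ℝ, 0 < η →
      schmidtEntropy m ≤ -quadForm (cfc Real.log σ) v + η * Fintype.card A := by
    intro η hη
    have hση : σ + η • 1 = spectralMatrix Y (s + η • 1) := by
      rw [spectralMatrix_add, spectralMatrix_smul, hspec]
      congr 2
      exact (map_one (spectralAlgHom hY)).symm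
    have h1 : quadForm (cfc Real.log σ) v ≤ quadForm (cfc Real.log (σ + η • 1)) v := by
      rw [hση, hspec, cfc_spectralMatrix _ hY, cfc_spectralMatrix _ hY, quadForm_spectralMatrix,
        quadForm_spectralMatrix]
      refine Finset.sum_le_sum fun k _ => ?_
      -- On the kernel of σ the convention ln 0 = 0 would break monotonicity, but `v` has no
      -- component there.
      rcases (hnn k).eq_or_lt with h0 | h0
      · have hz : σ *ᵥ (Yᵀ k) = 0 := by
          have hYY : Yᴴ * Y = 1 := Matrix.mem_unitaryGroup_iff'.1 hY
          have hcol : Yᴴ *ᵥ (Yᵀ k) = Pi.single k 1 := by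
            ext i
            have := congrFun (congrFun hYY i) k
            rw [Matrix.one_apply] at this
            rw [Pi.single_apply, ← this]; rfl
          rw [hspec, spectralMatrix, Matrix.mul_assoc, ← Matrix.mulVec_mulVec,
            ← Matrix.mulVec_mulVec, hcol]
          have : (Matrix.diagonal fun k => (s k : ℂ)) *ᵥ Pi.single k 1 = 0 := by
            ext i
            rw [Matrix.mulVec_diagonal, Pi.single_apply]
            by_cases hi : i = k
            · subst hi; simp [← h0]
            · simp [hi]
          rw [this, Matrix.mulVec_zero]
        have h2 := hker _ hz
        have h3 : (Yᴴ *ᵥ v) k = star (star v ⬝ᵥ Yᵀ k) := by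
          simp only [Matrix.mulVec, dotProduct, star_sum, star_mul, Pi.star_apply, star_star]
          rfl
        rw [h3, h2]; simp
      · have : Real.log (s k) ≤ Real.log (s k + η) := Real.log_le_log h0 (by linarith)
        simp only [Function.comp_apply, Pi.add_apply, Pi.smul_apply, Pi.one_apply, smul_eq_mul,
          mul_one]
        gcongr
    have hτη : (τ + η • 1).PosDef := by
      rw [add_comm]
      exact (Matrix.PosDef.one.smul hη).add_posSemidef hτ0
    have h2 : σ + η • 1 ≤ (τ + η • 1) ⊗ₖ (1 : Matrix B B ℂ) := by
      rw [Matrix.add_kronecker, Matrix.smul_kronecker, Matrix.one_kronecker_one]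
      gcongr
    have h3 : (σ + η • 1).PosDef := by
      rw [add_comm]
      exact (Matrix.PosDef.one.smul hη).add_posSemidef hσ0
    have h4 := quadForm_log_mono h3 h2 v
    rw [cfc_kronecker_one _ hτη.1, hv, hm.quadForm_kronecker_one hV, ← hv] at h4
    have hqn : ∀ i, 0 ≤ quadForm (τ + η • 1) (Uᵀ i) := fun i =>
      hτη.posSemidef.re_dotProduct_nonneg _
    have h5 : ∑ k, m k ^ 2 * quadForm (cfc Real.log (τ + η • 1)) (Uᵀ k.1)
        ≤ ∑ k, ((if m k = 0 then 0 else quadForm (τ + η • 1) (Uᵀ k.1))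
          + (-Real.negMulLog (m k ^ 2) - m k ^ 2)) := by
      refine Finset.sum_le_sum fun k _ => ?_
      by_cases h0 : m k = 0
      · simp [h0]
      · have hc : 0 < m k ^ 2 := by positivity
        have := mul_le_mul_of_nonneg_left (quadForm_log_le hτη hc (Uᵀ k.1)) hc.le
        rw [quadForm_one_col hU, mul_add, mul_div_cancel₀ _ hc.ne'] at this
        rw [if_neg h0, Real.negMulLog]
        linarith
    have h6 := hm.sum_support_le hqn
    rw [sum_quadForm_col hU, Matrix.trace_add, Matrix.trace_smul, Matrix.trace_one, hτ1] at h6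
    rw [Finset.sum_add_distrib, Finset.sum_sub_distrib, Finset.sum_neg_distrib, hm1] at h5
    have h7 : (1 + η • (Fintype.card A : ℂ)).re = 1 + η * Fintype.card A := by
      simp
    rw [h7] at h6
    change ∑ k, Real.negMulLog (m k ^ 2) ≤ _
    linarith
  refine le_of_forall_pos_le_add fun ε hε => ?_
  have hA : (0 : ℝ) ≤ Fintype.card A := Nat.cast_nonneg _
  refine (hkey (ε / (Fintype.card A + 1)) (by positivity)).trans ?_
  have : ε / (Fintype.card A + 1) * Fintype.card A ≤ ε := by
    rw [div_mul_eq_mul_div, div_le_iff₀ (by positivity)]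
    nlinarith
  linarith

/-- The relative entropy of entanglement of a pure state is at least the entropy of its Schmidt
coefficients. -/
lemma schmidtEntropy_le_toReal {Ψ : EuclideanSpace ℂ (A × B)} (hΨ : ‖Ψ‖ = 1)
    {U : Matrix A A ℂ} {V : Matrix B B ℂ}
    (hU : U ∈ Matrix.unitaryGroup A ℂ) (hV : V ∈ Matrix.unitaryGroup B ℂ) {m : A × B → ℝ}
    (hm : IsSchmidt m) (hm1 : ∑ k, m k ^ 2 = 1)
    (hv : (fun i => Ψ i) = (U ⊗ₖ V) *ᵥ (fun k => (m k : ℂ))) :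
    schmidtEntropy m ≤ (relEntropyEntanglement (pureState Ψ)).toReal := by
  have hval : ∀ σ : Matrix (A × B) (A × B) ℂ,
      (pureState Ψ * cfc Real.log (pureState Ψ) - pureState Ψ * cfc Real.log σ).trace.re
        = -quadForm (cfc Real.log σ) Ψ := by
    intro σ
    rw [cfc_log_pureState hΨ, mul_zero, zero_sub, Matrix.trace_neg, Complex.neg_re,
      trace_pureState_mul]
  have hlow : (schmidtEntropy m : EReal) ≤ relEntropyEntanglement (pureState Ψ) := by
    refine le_iInf₂ fun σ hσ => ?_
    rw [relEntropy]
    split_ifs with h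
    · rw [hval, EReal.coe_le_coe_iff]
      refine schmidtEntropy_le_neg_quadForm_log hU hV hm hm1 hσ hv fun w hw => ?_
      have h1 : w ∈ LinearMap.ker (Matrix.toLin' (pureState Ψ)) := h (by simpa using hw)
      have h2 : pureState Ψ *ᵥ w = 0 := by simpa using h1
      rw [pureState_mulVec] at h2
      have h3 := congrArg (fun u => star (fun i => Ψ i) ⬝ᵥ u) h2
      simpa [dotProduct_smul, star_dotProduct_of_norm_eq_one hΨ] using h3
    · exact le_top
  -- Needed because `toReal` sends `⊤` to 0. A noisy Schmidt state has full rank and gives a finite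
  -- value.
  have htop : relEntropyEntanglement (pureState Ψ) ≠ ⊤ := by
    have hmem := schmidtState_mem hU hV hm1 (x := 1 / 2) (by norm_num) (by norm_num)
    have hpd := schmidtState_posDef hU hV hm1 (x := 1 / 2) (by norm_num) (by norm_num)
    refine ne_top_of_le_ne_top ?_ (iInf₂_le _ hmem)
    have hker : LinearMap.ker (Matrix.toLin' (schmidtState U V m (1 / 2))) = ⊥ := by
      rw [LinearMap.ker_eq_bot]
      exact Matrix.mulVec_injective_of_isUnit hpd.isUnit
    rw [relEntropy, if_pos (by rw [hker]; exact bot_le)]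
    exact EReal.coe_ne_top _
  rw [← EReal.coe_le_coe_iff]
  exact hlow.trans (EReal.le_coe_toReal htop)

end Separable
end EntRate

namespace EntRate

/-! ### Lindblad evolution: trace, positivity and Taylor bound. -/

section Evolution

variable {n : Type*} [Fintype n] [DecidableEq n] {κ : Type*} [Fintype κ]

lemma _root_.ContinuousOn.quadForm {X : Type*} [TopologicalSpace X] {f : X → Matrix n n ℂ}
    {g : X → n → ℂ} {D : Set X} (hf : ContinuousOn f D) (hg : ContinuousOn g D) :
    ContinuousOn (fun q => quadForm (f q) (g q)) D := by
  unfold EntRate.quadForm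
  simp only [Matrix.mulVec, dotProduct]
  have hfi : ∀ i j, ContinuousOn (fun q => f q i j) D := fun i j =>
    (continuous_id.matrix_elem i j).comp_continuousOn hf
  have hgi : ∀ i, ContinuousOn (fun q => g q i) D := fun i =>
    (continuous_apply i).comp_continuousOn hg
  refine Complex.continuous_re.comp_continuousOn (continuousOn_finsetSum _ fun i _ => ?_)
  exact (continuous_star.comp_continuousOn (hgi i)).mul
    (continuousOn_finsetSum _ fun j _ => (hfi i j).mul (hgi j))

/-- `quadForm X v` as a continuous linear function of `X`. -/
noncomputable def quadFormCLM (v : n → ℂ) : Matrix n n ℂ →L[ℝ] ℝ :=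
  LinearMap.toContinuousLinearMap
    { toFun := fun X => quadForm X v
      map_add' := fun X Y => quadForm_add X Y v
      map_smul' := fun c X => quadForm_smul c X v }

lemma quadFormCLM_apply (v : n → ℂ) (X : Matrix n n ℂ) : quadFormCLM v X = quadForm X v := rfl

/-- The norm of `X v` for the Euclidean norm. -/
lemma norm_toLp_mulVec_le (X : Matrix n n ℂ) (v : n → ℂ) :
    ‖WithLp.toLp 2 (X *ᵥ v)‖ ≤ ‖X‖ * ‖WithLp.toLp 2 v‖ :=
  Matrix.l2_opNorm_mulVec X (WithLp.toLp 2 v)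

lemma norm_dotProduct_mulVec_le (X : Matrix n n ℂ) (v : n → ℂ) :
    ‖star v ⬝ᵥ X *ᵥ v‖ ≤ ‖X‖ * ‖WithLp.toLp 2 v‖ ^ 2 := by
  have h : star v ⬝ᵥ X *ᵥ v = inner ℂ (WithLp.toLp 2 v) (WithLp.toLp 2 (X *ᵥ v)) := by
    rw [EuclideanSpace.inner_eq_star_dotProduct, dotProduct_comm]
  rw [h]
  refine (norm_inner_le_norm _ _).trans ?_
  have := mul_le_mul_of_nonneg_left (norm_toLp_mulVec_le X v) (norm_nonneg (WithLp.toLp 2 v))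
  refine this.trans (le_of_eq ?_)
  ring

lemma norm_toLp_sq (v : n → ℂ) : ‖WithLp.toLp 2 v‖ ^ 2 = ∑ k, ‖v k‖ ^ 2 :=
  EuclideanSpace.norm_sq_eq _

lemma abs_quadForm_le (X : Matrix n n ℂ) (v : n → ℂ) :
    |quadForm X v| ≤ ‖X‖ * ‖WithLp.toLp 2 v‖ ^ 2 :=
  (Complex.abs_re_le_norm _).trans (norm_dotProduct_mulVec_le X v)

/-- The generator as a linear map. -/
noncomputable def lindbladMap (H : Matrix n n ℂ) (L : κ → Matrix n n ℂ) :
    Matrix n n ℂ →ₗ[ℂ] Matrix n n ℂ where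
  toFun := lindblad H L
  map_add' X Y := by
    simp only [lindblad, Matrix.mul_add, Matrix.add_mul, smul_add, Finset.sum_add_distrib,
      smul_sub, Finset.sum_sub_distrib]
    abel
  map_smul' c X := by
    simp only [lindblad, Matrix.mul_smul, Matrix.smul_mul, smul_sub, smul_add, Finset.smul_sum,
      Finset.sum_sub_distrib, RingHom.id_apply, smul_comm c]

variable {H : Matrix n n ℂ} {L : κ → Matrix n n ℂ}

lemma lindblad_sub (X Y : Matrix n n ℂ) :
    lindblad H L (X - Y) = lindblad H L X - lindblad H L Y :=
  map_sub (lindbladMap H L) X Y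

lemma lindblad_conjTranspose (hH : H.IsHermitian) (X : Matrix n n ℂ) :
    (lindblad H L X)ᴴ = lindblad H L Xᴴ := by
  simp only [lindblad, Matrix.conjTranspose_add, Matrix.conjTranspose_sub,
    Matrix.conjTranspose_smul, Matrix.conjTranspose_sum, Matrix.conjTranspose_mul,
    Matrix.conjTranspose_conjTranspose, hH.eq]
  congr 1
  · simp [← smul_neg]
  · refine Finset.sum_congr rfl fun α _ => ?_
    simp only [Matrix.mul_assoc, star_div₀, star_one, star_ofNat]
    abel

lemma trace_lindblad (X : Matrix n n ℂ) : (lindblad H L X).trace = 0 := by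
  simp only [lindblad, Matrix.trace_add, Matrix.trace_sub, Matrix.trace_smul, Matrix.trace_sum,
    smul_eq_mul]
  rw [Matrix.trace_mul_comm H X, sub_self, mul_zero, zero_add]
  refine Finset.sum_eq_zero fun α _ => ?_
  rw [Matrix.trace_mul_comm X, Matrix.trace_mul_comm (L α * X), ← Matrix.mul_assoc]
  ring

/-- The Lipschitz constant of the generator. -/
noncomputable def generatorBound (H : Matrix n n ℂ) (L : κ → Matrix n n ℂ) : ℝ :=
  2 * (‖H‖ + ∑ α, ‖L α‖ ^ 2)

lemma generatorBound_nonneg : 0 ≤ generatorBound H L := by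
  unfold generatorBound; positivity

lemma norm_lindblad_le (X : Matrix n n ℂ) : ‖lindblad H L X‖ ≤ generatorBound H L * ‖X‖ := by
  have h1 : ‖-Complex.I • (H * X - X * H)‖ ≤ 2 * ‖H‖ * ‖X‖ := by
    rw [norm_smul, norm_neg, Complex.norm_I, one_mul]
    refine (norm_sub_le _ _).trans ?_
    have := norm_mul_le H X
    have := norm_mul_le X H
    linarith
  have h2 : ∀ α, ‖L α * X * (L α)ᴴ - (1 / 2 : ℂ) • ((L α)ᴴ * L α * X)
      - (1 / 2 : ℂ) • (X * ((L α)ᴴ * L α))‖ ≤ 2 * ‖L α‖ ^ 2 * ‖X‖ := by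
    intro α
    have hc := Matrix.l2_opNorm_conjTranspose (L α)
    have hd : ‖(L α)ᴴ * L α‖ = ‖L α‖ ^ 2 := by
      rw [Matrix.l2_opNorm_conjTranspose_mul_self]; ring
    have hhalf : ‖(1 / 2 : ℂ)‖ = 1 / 2 := by norm_num
    have a1 : ‖L α * X * (L α)ᴴ‖ ≤ ‖L α‖ ^ 2 * ‖X‖ := by
      have b1 := norm_mul_le (L α * X) (L α)ᴴ
      have b2 := mul_le_mul_of_nonneg_right (norm_mul_le (L α) X) (norm_nonneg (L α)ᴴ)
      rw [hc] at b1 b2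
      calc _ ≤ _ := b1
        _ ≤ _ := b2
        _ = _ := by ring
    have a2 : ‖(1 / 2 : ℂ) • ((L α)ᴴ * L α * X)‖ ≤ 1 / 2 * (‖L α‖ ^ 2 * ‖X‖) := by
      rw [norm_smul, hhalf, ← hd]
      exact mul_le_mul_of_nonneg_left (norm_mul_le _ _) (by norm_num)
    have a3 : ‖(1 / 2 : ℂ) • (X * ((L α)ᴴ * L α))‖ ≤ 1 / 2 * (‖L α‖ ^ 2 * ‖X‖) := by
      rw [norm_smul, hhalf, ← hd, mul_comm ‖(L α)ᴴ * L α‖]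
      exact mul_le_mul_of_nonneg_left (norm_mul_le _ _) (by norm_num)
    have := norm_sub_le (L α * X * (L α)ᴴ - (1 / 2 : ℂ) • ((L α)ᴴ * L α * X))
      ((1 / 2 : ℂ) • (X * ((L α)ᴴ * L α)))
    have := norm_sub_le (L α * X * (L α)ᴴ) ((1 / 2 : ℂ) • ((L α)ᴴ * L α * X))
    linarith
  calc ‖lindblad H L X‖ ≤ 2 * ‖H‖ * ‖X‖ + ∑ α, 2 * ‖L α‖ ^ 2 * ‖X‖ :=
        (norm_add_le _ _).trans (add_le_add h1 ((norm_sum_le _ _).trans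
          (Finset.sum_le_sum fun α _ => h2 α)))
    _ = _ := by rw [← Finset.sum_mul, ← Finset.mul_sum, generatorBound]; ring

/-- At a null vector only the jump terms L X L† survive. This is what keeps the evolution inside the
positive cone. -/
lemma quadForm_lindblad_nonneg {X : Matrix n n ℂ} (hX : X.PosSemidef) {v : n → ℂ}
    (hv : X *ᵥ v = 0) : 0 ≤ quadForm (lindblad H L X) v := by
  have hv' : star v ᵥ* X = 0 := by
    rw [← star_eq_zero, Matrix.star_vecMul, star_star, hX.1.eq, hv]
  have h1 : ∀ Y : Matrix n n ℂ, star v ⬝ᵥ (Y * X) *ᵥ v = 0 := fun Y => by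
    rw [← Matrix.mulVec_mulVec, hv, Matrix.mulVec_zero, dotProduct_zero]
  have h2 : ∀ Y : Matrix n n ℂ, star v ⬝ᵥ (X * Y) *ᵥ v = 0 := fun Y => by
    rw [← Matrix.mulVec_mulVec, Matrix.dotProduct_mulVec, hv', zero_dotProduct]
  have h3 : star v ⬝ᵥ lindblad H L X *ᵥ v
      = ∑ α, star v ⬝ᵥ (L α * X * (L α)ᴴ) *ᵥ v := by
    simp only [lindblad, Matrix.add_mulVec, Matrix.sub_mulVec, Matrix.smul_mulVec,
      Matrix.sum_mulVec, dotProduct_add, dotProduct_sub, dotProduct_smul, dotProduct_sum, h1, h2,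
      smul_zero, sub_zero, zero_add]
  rw [quadForm, h3, Complex.re_sum]
  exact Finset.sum_nonneg fun α _ => (hX.mul_mul_conjTranspose_same (L α)).re_dotProduct_nonneg v

variable {ρ : ℝ → Matrix n n ℂ}

lemma IsEvolution.continuousOn (h : IsEvolution H L ρ) : ContinuousOn ρ (Set.Ici 0) :=
  fun t ht => (h t ht).continuousWithinAt

lemma IsEvolution.hasDerivWithinAt_Ici (h : IsEvolution H L ρ) {t : ℝ} (ht : 0 ≤ t) :
    HasDerivWithinAt ρ (lindblad H L (ρ t)) (Set.Ici t) t :=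
  (h t ht).mono (Set.Ici_subset_Ici.2 ht)

lemma IsEvolution.trace_eq (h : IsEvolution H L ρ) {t : ℝ} (ht : 0 ≤ t) :
    (ρ t).trace = (ρ 0).trace := by
  let φ : Matrix n n ℂ →L[ℝ] ℂ := LinearMap.toContinuousLinearMap (Matrix.traceLinearMap n ℝ ℂ)
  have h1 : ContinuousOn (fun s => φ (ρ s)) (Set.Icc 0 t) :=
    φ.continuous.comp_continuousOn (h.continuousOn.mono Set.Icc_subset_Ici_self)
  refine constant_of_has_deriv_right_zero h1 (fun s hs => ?_) t ⟨ht, le_rfl⟩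
  have := φ.hasFDerivAt.comp_hasDerivWithinAt s (h.hasDerivWithinAt_Ici hs.1)
  have h0 : φ (lindblad H L (ρ s)) = 0 := trace_lindblad (ρ s)
  rwa [h0] at this

/-- The defect ρ† - ρ solves the same linear equation from zero, so Grönwall's inequality makes it
vanish. -/
lemma IsEvolution.isHermitian (hH : H.IsHermitian) (h : IsEvolution H L ρ)
    (h0 : (ρ 0).IsHermitian) {t : ℝ} (ht : 0 ≤ t) : (ρ t).IsHermitian := by
  let φ : Matrix n n ℂ →L[ℝ] Matrix n n ℂ :=
    LinearMap.toContinuousLinearMap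
      (Matrix.conjTransposeLinearEquiv n n ℝ ℂ).toLinearMap
  have h1 : ContinuousOn (fun s => φ (ρ s) - ρ s) (Set.Icc 0 t) :=
    (φ.continuous.comp_continuousOn (h.continuousOn.mono Set.Icc_subset_Ici_self)).sub
      (h.continuousOn.mono Set.Icc_subset_Ici_self)
  have h2 : ∀ s ∈ Set.Ico 0 t, HasDerivWithinAt (fun s => φ (ρ s) - ρ s)
      (lindblad H L (φ (ρ s) - ρ s)) (Set.Ici s) s := by
    intro s hs
    have := (φ.hasFDerivAt.comp_hasDerivWithinAt s (h.hasDerivWithinAt_Ici hs.1)).sub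
      (h.hasDerivWithinAt_Ici hs.1)
    rw [lindblad_sub]
    have h3 : φ (lindblad H L (ρ s)) = lindblad H L (φ (ρ s)) := lindblad_conjTranspose hH (ρ s)
    rwa [h3] at this
  have h4 : ‖φ (ρ 0) - ρ 0‖ ≤ 0 := by
    rw [show φ (ρ 0) = ρ 0 from h0, sub_self, norm_zero]
  have h5 := norm_le_gronwallBound_of_norm_deriv_right_le h1 h2 h4
    (K := generatorBound H L) (ε := 0)
    (fun s _ => by rw [add_zero]; exact norm_lindblad_le _) t ⟨ht, le_rfl⟩
  rw [gronwallBound_ε0, zero_mul] at h5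
  exact sub_eq_zero.1 (norm_le_zero_iff.1 h5)

lemma isCompact_unitVectors : IsCompact {v : n → ℂ | ∑ k, ‖v k‖ ^ 2 = 1} := by
  refine Metric.isCompact_of_isClosed_isBounded (isClosed_eq (by fun_prop) continuous_const) ?_
  refine (Metric.isBounded_closedBall (x := (0 : n → ℂ)) (r := 1)).subset fun v hv => ?_
  rw [mem_closedBall_zero_iff, pi_norm_le_iff_of_nonneg zero_le_one]
  intro k
  have : ‖v k‖ ^ 2 ≤ 1 := by
    rw [← show ∑ k, ‖v k‖ ^ 2 = 1 from hv]
    exact Finset.single_le_sum (f := fun k => ‖v k‖ ^ 2) (fun i _ => sq_nonneg _)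
      (Finset.mem_univ k)
  exact (sq_le_one_iff₀ (norm_nonneg _)).1 this

lemma posSemidef_of_quadForm_nonneg {X : Matrix n n ℂ} (hX : X.IsHermitian)
    (h : ∀ v, ∑ k, ‖v k‖ ^ 2 = 1 → 0 ≤ quadForm X v) : X.PosSemidef := by
  refine Matrix.PosSemidef.of_dotProduct_mulVec_nonneg hX fun v => ?_
  rw [Complex.nonneg_iff]
  refine ⟨?_, (hX.im_star_dotProduct_mulVec_self v).symm⟩
  change 0 ≤ quadForm X v
  by_cases hv : v = 0
  · simp [hv, quadForm]
  set r : ℝ := ‖WithLp.toLp 2 v‖ with hr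
  have hr0 : 0 < r := by
    rw [hr, norm_pos_iff]
    simpa using hv
  have h1 : ∑ k, ‖(((r⁻¹ : ℝ) : ℂ) • v) k‖ ^ 2 = 1 := by
    simp only [Pi.smul_apply, norm_smul, mul_pow, ← Finset.mul_sum]
    rw [← norm_toLp_sq, Complex.norm_real, norm_inv, Real.norm_of_nonneg hr0.le, inv_pow,
      inv_mul_cancel₀ (by positivity)]
  have h2 := h _ h1
  have h3 : quadForm X (((r⁻¹ : ℝ) : ℂ) • v) = r⁻¹ * (r⁻¹ * quadForm X v) := by
    rw [quadForm, Matrix.mulVec_smul, dotProduct_smul, star_smul, smul_dotProduct,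
      Complex.star_def, Complex.conj_ofReal, smul_eq_mul, smul_eq_mul, Complex.re_ofReal_mul,
      Complex.re_ofReal_mul]
    rfl
  rw [h3] at h2
  have hri : 0 < r⁻¹ := inv_pos.2 hr0
  exact nonneg_of_mul_nonneg_right (nonneg_of_mul_nonneg_right h2 hri) hri

/-- Barrier argument for R = ρ + η e^{Cs}·1. At the first time R has a null vector `w`, the
derivative of ⟨w, R w⟩ must be nonpositive; but it is at least η e^{Cs}(C - ‖𝓛(1)‖) = η e^{Cs} > 0.
-/
lemma quadForm_perturbed_pos (hH : H.IsHermitian) (h : IsEvolution H L ρ)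
    (h0 : (ρ 0).PosSemidef) {η : ℝ} (hη : 0 < η) {t : ℝ} (ht : 0 ≤ t) {v : n → ℂ}
    (hv : ∑ k, ‖v k‖ ^ 2 = 1) :
    0 < quadForm (ρ t + (η * Real.exp ((‖lindblad H L 1‖ + 1) * t)) • (1 : Matrix n n ℂ)) v := by
  set C := ‖lindblad H L 1‖ + 1 with hC
  set R : ℝ → Matrix n n ℂ := fun s => ρ s + (η * Real.exp (C * s)) • (1 : Matrix n n ℂ) with hR
  have hRc : ContinuousOn R (Set.Ici 0) := h.continuousOn.add (by fun_prop)
  set S := {v : n → ℂ | ∑ k, ‖v k‖ ^ 2 = 1}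
  have hSc : IsCompact S := isCompact_unitVectors
  by_contra hneg
  push Not at hneg
  set D : Set (ℝ × (n → ℂ)) := Set.Icc 0 t ×ˢ S
  have hD : IsCompact D := isCompact_Icc.prod hSc
  have hf : ContinuousOn (fun q : ℝ × (n → ℂ) => quadForm (R q.1) q.2) D := by
    exact (hRc.comp continuousOn_fst fun q hq => hq.1.1).quadForm continuousOn_snd
  -- Compactness of the set of bad pairs (time, unit vector) provides an earliest bad time.
  set K : Set (ℝ × (n → ℂ)) := D ∩ (fun q : ℝ × (n → ℂ) => quadForm (R q.1) q.2) ⁻¹' Set.Iic 0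
  have hK : IsCompact K :=
    hD.of_isClosed_subset (hf.preimage_isClosed_of_isClosed hD.isClosed isClosed_Iic)
      Set.inter_subset_left
  obtain ⟨⟨s, w⟩, ⟨⟨hs, hw⟩, hsw⟩, hmin⟩ :=
    hK.exists_isMinOn ⟨(t, v), ⟨⟨⟨ht, le_rfl⟩, hv⟩, hneg⟩⟩ continuousOn_fst
  have hsw' : quadForm (R s) w ≤ 0 := hsw
  replace hs : s ∈ Set.Icc 0 t := hs
  have hbefore : ∀ s' ∈ Set.Ico 0 s, ∀ u ∈ S, 0 < quadForm (R s') u := by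
    intro s' hs' u hu
    by_contra hle
    push Not at hle
    have := hmin (show (s', u) ∈ K from ⟨⟨⟨hs'.1, hs'.2.le.trans hs.2⟩, hu⟩, hle⟩)
    exact absurd hs'.2 (not_lt.2 this)
  have hs0 : 0 < s := by
    rcases hs.1.eq_or_lt with hz | hz
    · exfalso
      have h1 : quadForm (R s) w = quadForm (ρ 0) w + η := by
        rw [← hz, hR]
        simp only [mul_zero, Real.exp_zero, mul_one]
        rw [quadForm_add, quadForm_smul, quadForm_one, show ∑ k, ‖w k‖ ^ 2 = 1 from hw, mul_one]
      have h2 : 0 ≤ quadForm (ρ 0) w := h0.re_dotProduct_nonneg w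
      linarith
    · exact hz
  have hcont : ∀ u, ContinuousWithinAt (fun s => quadForm (R s) u) (Set.Iio s) s := by
    intro u
    have h1 : ContinuousAt R s := hRc.continuousAt (Ici_mem_nhds hs0)
    exact ((quadFormCLM u).continuous.continuousAt.comp h1).continuousWithinAt
  have hev : ∀ᶠ s' in nhdsWithin s (Set.Iio s), s' ∈ Set.Ico 0 s := by
    filter_upwards [self_mem_nhdsWithin, mem_nhdsWithin_of_mem_nhds (Ioi_mem_nhds hs0)]
      with s' h1 h2 using ⟨le_of_lt h2, h1⟩
  have hRH : (R s).IsHermitian := by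
    refine (h.isHermitian hH h0.1 hs.1).add ?_
    rw [Matrix.IsHermitian, Matrix.conjTranspose_smul, Matrix.conjTranspose_one]; simp
  have hRpsd : (R s).PosSemidef := by
    refine posSemidef_of_quadForm_nonneg hRH fun u hu => ?_
    refine ge_of_tendsto (hcont u) ?_
    filter_upwards [hev] with s' hs' using (hbefore s' hs' u hu).le
  have hzero : quadForm (R s) w = 0 := le_antisymm hsw' (hRpsd.re_dotProduct_nonneg w)
  have hnull : R s *ᵥ w = 0 := by
    rw [← hRpsd.dotProduct_mulVec_zero_iff]
    exact Complex.ext hzero (hRH.im_star_dotProduct_mulVec_self w)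
  have hderR : HasDerivAt R (lindblad H L (ρ s) + (η * (Real.exp (C * s) * C)) •
      (1 : Matrix n n ℂ)) s := by
    have h1 : HasDerivAt ρ (lindblad H L (ρ s)) s := (h s hs.1).hasDerivAt (Ici_mem_nhds hs0)
    have h2 : HasDerivAt (fun s => η * Real.exp (C * s)) (η * (Real.exp (C * s) * C)) s := by
      have := (((hasDerivAt_id s).const_mul C).exp).const_mul η
      simpa using this
    exact h1.add (h2.smul_const _)
  have hder := ((quadFormCLM w).hasFDerivAt.comp_hasDerivAt s hderR).hasDerivWithinAt
    (s := Set.Iio s)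
  rw [hasDerivWithinAt_iff_tendsto_slope' (by simp)] at hder
  -- The form at `w` is positive before `s` and zero at `s`, so its left slopes are nonpositive.
  have hle : quadFormCLM w (lindblad H L (ρ s) + (η * (Real.exp (C * s) * C)) •
      (1 : Matrix n n ℂ)) ≤ 0 := by
    refine le_of_tendsto hder ?_
    filter_upwards [hev] with s' hs'
    rw [slope_def_field]
    refine div_nonpos_of_nonneg_of_nonpos ?_ (by linarith [hs'.2])
    have := hbefore s' hs' w hw
    simp only [Function.comp_apply, quadFormCLM_apply, hzero, sub_zero]
    exact this.le
  have hρ : lindblad H L (ρ s)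
      = lindblad H L (R s) - (η * Real.exp (C * s)) • lindblad H L 1 := by
    have h1 : ρ s = R s - (η * Real.exp (C * s)) • (1 : Matrix n n ℂ) := by simp [hR]
    conv_lhs => rw [h1]
    rw [lindblad_sub]
    congr 1
    exact ((lindbladMap H L).restrictScalars ℝ).map_smul _ _
  have hb := (le_abs_self _).trans (abs_quadForm_le (lindblad H L 1) w)
  rw [norm_toLp_sq, show ∑ k, ‖w k‖ ^ 2 = 1 from hw, mul_one] at hb
  rw [quadFormCLM_apply, hρ, quadForm_add, sub_eq_add_neg, ← neg_smul, quadForm_add,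
    quadForm_smul, quadForm_smul, quadForm_one, show ∑ k, ‖w k‖ ^ 2 = 1 from hw] at hle
  have hp := quadForm_lindblad_nonneg (H := H) (L := L) hRpsd hnull
  have he : 0 < η * Real.exp (C * s) := by positivity
  nlinarith

lemma IsEvolution.posSemidef (hH : H.IsHermitian) (h : IsEvolution H L ρ)
    (h0 : (ρ 0).PosSemidef) {t : ℝ} (ht : 0 ≤ t) : (ρ t).PosSemidef := by
  refine posSemidef_of_quadForm_nonneg (h.isHermitian hH h0.1 ht) fun v hv => ?_
  refine le_of_forall_pos_le_add fun ε hε => ?_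
  have he := Real.exp_pos ((‖lindblad H L 1‖ + 1) * t)
  have h1 := quadForm_perturbed_pos hH h h0 (div_pos hε he) ht hv
  rw [div_mul_cancel₀ _ he.ne', quadForm_add, quadForm_smul, quadForm_one, hv, mul_one] at h1
  exact h1.le

lemma IsState.norm_le_one {σ : Matrix n n ℂ} (hσ : IsState σ) : ‖σ‖ ≤ 1 :=
  (CStarAlgebra.norm_le_one_iff_of_nonneg σ (Matrix.nonneg_iff_posSemidef.2 hσ.1)).2 hσ.le_one

lemma isState_pureState {Ψ : EuclideanSpace ℂ n} (hΨ : ‖Ψ‖ = 1) : IsState (pureState Ψ) := by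
  refine ⟨Matrix.posSemidef_vecMulVec_self_star _, ?_⟩
  rw [pureState, Matrix.trace_vecMulVec, dotProduct_comm]
  exact star_dotProduct_of_norm_eq_one hΨ

lemma IsEvolution.isState (hH : H.IsHermitian) (h : IsEvolution H L ρ) (h0 : IsState (ρ 0))
    {t : ℝ} (ht : 0 ≤ t) : IsState (ρ t) :=
  ⟨h.posSemidef hH h0.1 ht, (h.trace_eq ht).trans h0.2⟩

/-- Second order Taylor bound for the evolution of a state, uniform in the state. -/
lemma IsEvolution.norm_sub_le (hH : H.IsHermitian) (h : IsEvolution H L ρ) (h0 : IsState (ρ 0))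
    {t : ℝ} (ht : 0 ≤ t) :
    ‖ρ t - ρ 0 - t • lindblad H L (ρ 0)‖ ≤ generatorBound H L ^ 2 * t ^ 2 := by
  set c := generatorBound H L
  have hc : 0 ≤ c := generatorBound_nonneg
  have hcont : ContinuousOn ρ (Set.Icc 0 t) := h.continuousOn.mono Set.Icc_subset_Ici_self
  -- States have norm at most 1, so the speed is at most c. Then ρ(s) - sG has derivative 𝓛(ρ(s) -
  -- ρ(0)), of norm at most c·ct.
  have h1 : ∀ s ∈ Set.Icc 0 t, ‖ρ s - ρ 0‖ ≤ c * (s - 0) := by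
    refine norm_image_sub_le_of_norm_deriv_right_le_segment hcont
      (fun s hs => h.hasDerivWithinAt_Ici hs.1) fun s hs => ?_
    refine (norm_lindblad_le _).trans ?_
    exact mul_le_of_le_one_right hc (h.isState hH h0 hs.1).norm_le_one
  set G := lindblad H L (ρ 0)
  have h2 : ContinuousOn (fun s => ρ s - s • G) (Set.Icc 0 t) := hcont.sub (by fun_prop)
  have h3 := norm_image_sub_le_of_norm_deriv_right_le_segment (C := c * (c * t)) h2
    (f' := fun s => lindblad H L (ρ s) - G) (fun s hs => ?_) (fun s hs => ?_) t ⟨ht, le_rfl⟩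
  · refine le_trans (le_of_eq ?_) (h3.trans (le_of_eq ?_))
    · congr 1; simp only [zero_smul, sub_zero]; abel
    · ring
  · have := ((hasDerivAt_id s).smul_const G).hasDerivWithinAt (s := Set.Ici s)
    rw [one_smul] at this
    exact (h.hasDerivWithinAt_Ici hs.1).sub this
  · rw [← lindblad_sub]
    refine (norm_lindblad_le _).trans ?_
    gcongr
    refine (h1 s ⟨hs.1, hs.2.le⟩).trans ?_
    rw [sub_zero]
    exact mul_le_mul_of_nonneg_left hs.2.le hc

end Evolution
end EntRate

namespace EntRate

/-! ### First-order motion of a pure state. -/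

section FirstOrder

variable {n : Type*} [Fintype n] [DecidableEq n] {κ : Type*} [Fintype κ]
  {H : Matrix n n ℂ} {L : κ → Matrix n n ℂ} {Ψ : EuclideanSpace ℂ n}

lemma pureState_mulVec_self (hΨ : ‖Ψ‖ = 1) : pureState Ψ *ᵥ (fun i => Ψ i) = fun i => Ψ i := by
  rw [pureState_mulVec, star_dotProduct_of_norm_eq_one hΨ, one_smul]

lemma norm_expectation_le (hΨ : ‖Ψ‖ = 1) (X : Matrix n n ℂ) :
    ‖star (fun i => Ψ i) ⬝ᵥ X *ᵥ (fun i => Ψ i)‖ ≤ ‖X‖ := by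
  have h := norm_dotProduct_mulVec_le X (fun i => Ψ i)
  rwa [norm_toLp_sq, sum_norm_sq_eq_one hΨ, mul_one] at h

lemma norm_toLp_mulVec_le_norm (hΨ : ‖Ψ‖ = 1) (X : Matrix n n ℂ) :
    ‖WithLp.toLp 2 (X *ᵥ (fun i => Ψ i))‖ ≤ ‖X‖ := by
  have h := norm_toLp_mulVec_le X (fun i => Ψ i)
  rwa [show ‖WithLp.toLp 2 (fun i => Ψ i)‖ = 1 from hΨ, mul_one] at h

/-- The explicit multiple of Ψ only shifts the approximate eigenvalue; the remainder alone displaces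
the eigenvector. Splitting the commutator this way makes it cost ‖H‖ rather than 2‖H‖. -/
lemma lindblad_pureState_mulVec (hΨ : ‖Ψ‖ = 1) :
    lindblad H L (pureState Ψ) *ᵥ (fun i => Ψ i)
      = (Complex.I * (star (fun i => Ψ i) ⬝ᵥ H *ᵥ (fun i => Ψ i))
          - ∑ α, (1 / 2 : ℂ) * (star (fun i => Ψ i) ⬝ᵥ ((L α)ᴴ * L α) *ᵥ (fun i => Ψ i))) •
            (fun i => Ψ i)
        + (-Complex.I • (H *ᵥ (fun i => Ψ i))
          + ∑ α, ((star (fun i => Ψ i) ⬝ᵥ (L α)ᴴ *ᵥ (fun i => Ψ i)) • (L α *ᵥ (fun i => Ψ i))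
            - (1 / 2 : ℂ) • (((L α)ᴴ * L α) *ᵥ (fun i => Ψ i)))) := by
  have hP := pureState_mulVec_self hΨ
  have hP' := pureState_mulVec Ψ
  generalize (fun i => Ψ i) = ψ at hP hP' ⊢
  have h1 : ∀ X : Matrix n n ℂ, (X * pureState Ψ) *ᵥ ψ = X *ᵥ ψ := fun X => by
    rw [← Matrix.mulVec_mulVec, hP]
  have h2 : ∀ X : Matrix n n ℂ, (pureState Ψ * X) *ᵥ ψ = (star ψ ⬝ᵥ X *ᵥ ψ) • ψ := fun X => by
    rw [← Matrix.mulVec_mulVec, hP']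
  have h3 : ∀ X Y : Matrix n n ℂ, (X * pureState Ψ * Y) *ᵥ ψ = (star ψ ⬝ᵥ Y *ᵥ ψ) • (X *ᵥ ψ) :=
    fun X Y => by rw [Matrix.mul_assoc, ← Matrix.mulVec_mulVec, h2, Matrix.mulVec_smul]
  simp only [lindblad, Matrix.add_mulVec, Matrix.sub_mulVec, Matrix.smul_mulVec,
    Matrix.sum_mulVec, h1, h2, h3, Finset.sum_sub_distrib, sub_smul, Finset.sum_smul, smul_sub,
    smul_smul]
  simp only [neg_smul, neg_mul]
  abel

lemma norm_expectation_gram_le (hΨ : ‖Ψ‖ = 1) (α : κ) :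
    ‖star (fun i => Ψ i) ⬝ᵥ ((L α)ᴴ * L α) *ᵥ (fun i => Ψ i)‖ ≤ ‖L α‖ ^ 2 := by
  refine (norm_expectation_le hΨ _).trans (le_of_eq ?_)
  rw [Matrix.l2_opNorm_conjTranspose_mul_self]; ring

/-- The generator maps `Ψ` into a multiple of `Ψ` plus a vector of controlled length. -/
lemma exists_lindblad_pureState_mulVec (hH : H.IsHermitian) (hΨ : ‖Ψ‖ = 1) :
    ∃ (g : ℂ) (u : n → ℂ), lindblad H L (pureState Ψ) *ᵥ (fun i => Ψ i) = g • (fun i => Ψ i) + u ∧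
      -(∑ α, ‖L α‖ ^ 2) ≤ g.re ∧ ‖WithLp.toLp 2 u‖ ≤ ‖H‖ + 3 / 2 * ∑ α, ‖L α‖ ^ 2 := by
  refine ⟨_, _, lindblad_pureState_mulVec hΨ, ?_, ?_⟩
  · have h1 : (Complex.I * (star (fun i => Ψ i) ⬝ᵥ H *ᵥ (fun i => Ψ i))).re = 0 := by
      have := hH.im_star_dotProduct_mulVec_self (fun i => Ψ i)
      rw [Complex.I_mul_re]
      exact neg_eq_zero.2 this
    have h2 : ‖∑ α, (1 / 2 : ℂ) * (star (fun i => Ψ i) ⬝ᵥ ((L α)ᴴ * L α) *ᵥ (fun i => Ψ i))‖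
        ≤ ∑ α, ‖L α‖ ^ 2 := by
      refine norm_sum_le_of_le _ fun α _ => ?_
      rw [norm_mul, show ‖(1 / 2 : ℂ)‖ = 1 / 2 by norm_num]
      have := norm_expectation_gram_le (L := L) hΨ α
      have := sq_nonneg ‖L α‖
      linarith
    have h3 := (Complex.re_le_norm _).trans h2
    rw [Complex.sub_re, h1]
    linarith
  · rw [WithLp.toLp_add, WithLp.toLp_smul, WithLp.toLp_sum]
    refine (norm_add_le _ _).trans (add_le_add ?_ ?_)
    · rw [norm_smul, norm_neg, Complex.norm_I, one_mul]
      exact norm_toLp_mulVec_le_norm hΨ H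
    · rw [Finset.mul_sum]
      refine norm_sum_le_of_le _ fun α _ => ?_
      rw [WithLp.toLp_sub, WithLp.toLp_smul, WithLp.toLp_smul]
      refine (norm_sub_le _ _).trans ?_
      rw [norm_smul, norm_smul, show ‖(1 / 2 : ℂ)‖ = 1 / 2 by norm_num]
      -- The constant 3/2 is 1 from ⟨L†⟩LΨ plus 1/2 from ½L†LΨ.
      have h1 := norm_expectation_le hΨ (L α)ᴴ
      rw [Matrix.l2_opNorm_conjTranspose] at h1
      have h2 := norm_toLp_mulVec_le_norm hΨ (L α)
      have h3 := norm_toLp_mulVec_le_norm hΨ ((L α)ᴴ * L α)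
      rw [Matrix.l2_opNorm_conjTranspose_mul_self] at h3
      have h4 := mul_le_mul h1 h2 (norm_nonneg _) (norm_nonneg _)
      nlinarith

/-- The initial fidelity loss: the Hamiltonian drops out, leaving ∑ (|⟨L⟩|² - ⟨L†L⟩). -/
lemma neg_sum_le_quadForm_lindblad (hΨ : ‖Ψ‖ = 1) :
    -(∑ α, ‖L α‖ ^ 2) ≤ quadForm (lindblad H L (pureState Ψ)) Ψ := by
  have hone := star_dotProduct_of_norm_eq_one hΨ
  have h : quadForm (lindblad H L (pureState Ψ)) Ψ
      = ∑ α, (‖star (fun i => Ψ i) ⬝ᵥ L α *ᵥ (fun i => Ψ i)‖ ^ 2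
        - (star (fun i => Ψ i) ⬝ᵥ ((L α)ᴴ * L α) *ᵥ (fun i => Ψ i)).re) := by
    change (star (fun i => Ψ i) ⬝ᵥ lindblad H L (pureState Ψ) *ᵥ (fun i => Ψ i)).re = _
    rw [lindblad_pureState_mulVec hΨ]
    generalize (fun i => Ψ i) = ψ at hone ⊢
    have hconj : ∀ α, star ψ ⬝ᵥ (L α)ᴴ *ᵥ ψ = star (star ψ ⬝ᵥ L α *ᵥ ψ) := fun α => by
      rw [← Matrix.star_dotProduct, Matrix.star_mulVec, ← Matrix.dotProduct_mulVec]
    have hn : ∀ z : ℂ, star z * z = ((‖z‖ ^ 2 : ℝ) : ℂ) := fun z => by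
      rw [Complex.star_def, ← Complex.normSq_eq_conj_mul_self, Complex.normSq_eq_norm_sq]
    simp only [dotProduct_add, dotProduct_smul, dotProduct_sum, dotProduct_sub, hone, hconj,
      smul_eq_mul, hn, mul_one, Finset.sum_sub_distrib, ← Finset.mul_sum]
    rw [← Complex.re_sum, ← Complex.ofReal_sum]
    generalize ∑ α, star ψ ⬝ᵥ ((L α)ᴴ * L α) *ᵥ ψ = q
    rw [← Complex.ofReal_re (∑ α, ‖star ψ ⬝ᵥ L α *ᵥ ψ‖ ^ 2), ← Complex.sub_re]
    congr 1
    rw [Complex.ofReal_re]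
    ring
  rw [h, ← Finset.sum_neg_distrib]
  refine Finset.sum_le_sum fun α _ => ?_
  have h1 := (Complex.re_le_norm _).trans (norm_expectation_gram_le (L := L) hΨ α)
  have h2 := sq_nonneg ‖star (fun i => Ψ i) ⬝ᵥ L α *ᵥ (fun i => Ψ i)‖
  linarith

end FirstOrder

/-! ### Perturbation of the top eigenvector. -/

section TopEigenvector

variable {n : Type*} [Fintype n] [DecidableEq n]

/-- If `ψ` is an approximate eigenvector of a state which is nearly pure, then the top
eigenvector is close to `ψ`, up to a phase. -/
lemma exists_top_eigenvector {Z : Matrix n n ℂ} (hZ : Z ∈ Matrix.unitaryGroup n ℂ) {p : n → ℝ}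
    (hp : ∀ k, 0 ≤ p k) (hp1 : ∑ k, p k = 1) {ψ : n → ℂ} (hψ : ∑ k, ‖ψ k‖ ^ 2 = 1) {a β : ℝ}
    (ha : 2 * a < 1) (hβ : 0 ≤ β) (hq : 1 - a ≤ quadForm (spectralMatrix Z p) ψ) {s : ℂ}
    (hs : 1 - a ≤ s.re)
    (hv : ‖WithLp.toLp 2 (spectralMatrix Z p *ᵥ ψ - s • ψ)‖ ≤ β) :
    ∃ k, 1 - a ≤ p k ∧ ∃ ω : ℂ, ‖ω‖ = 1 ∧ ∑ j, ‖(ω • Zᵀ k - ψ) j‖ ^ 2 ≤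
      (β / (1 - 2 * a) * (1 + β / (1 - 2 * a))) ^ 2 := by
  have hZZ : Zᴴ * Z = 1 := Matrix.mem_unitaryGroup_iff'.1 hZ
  set γ := 1 - 2 * a
  have hγ : 0 < γ := by simp only [γ]; linarith
  set χ := β / γ with hχ
  have hχ0 : 0 ≤ χ := by positivity
  set y := Zᴴ *ᵥ ψ with hy
  have hy1 : ∑ k, ‖y k‖ ^ 2 = 1 := by rw [hy, sum_norm_sq_conjTranspose_mulVec hZ, hψ]
  have hne : (Finset.univ : Finset n).Nonempty := by
    by_contra h
    rw [Finset.not_nonempty_iff_eq_empty] at h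
    rw [h] at hp1
    simp at hp1
  obtain ⟨k0, -, hmax⟩ := Finset.exists_max_image Finset.univ p hne
  have hk0 : 1 - a ≤ p k0 := by
    refine hq.trans ?_
    rw [quadForm_spectralMatrix]
    calc _ ≤ ∑ k, p k0 * ‖y k‖ ^ 2 := Finset.sum_le_sum fun k _ => by
            gcongr; exact hmax k (Finset.mem_univ k)
      _ = p k0 := by rw [← Finset.mul_sum, hy1, mul_one]
  have hoth : ∀ k, k ≠ k0 → p k ≤ a := by
    intro k hk
    have : p k + p k0 ≤ 1 := by
      rw [← hp1, ← Finset.sum_pair hk]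
      exact Finset.sum_le_sum_of_subset_of_nonneg (Finset.subset_univ _) fun i _ _ => hp i
    linarith
  have hres : ∑ k, ‖((p k : ℂ) - s) * y k‖ ^ 2 ≤ β ^ 2 := by
    have h1 : ∀ k, (Zᴴ *ᵥ (spectralMatrix Z p *ᵥ ψ - s • ψ)) k = ((p k : ℂ) - s) * y k := by
      intro k
      rw [Matrix.mulVec_sub, Matrix.mulVec_mulVec, spectralMatrix, Matrix.mul_assoc,
        ← Matrix.mul_assoc, hZZ, Matrix.one_mul, ← Matrix.mulVec_mulVec, Matrix.mulVec_smul,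
        ← hy, Pi.sub_apply, Matrix.mulVec_diagonal, Pi.smul_apply, smul_eq_mul, sub_mul]
    simp only [← h1]
    rw [sum_norm_sq_conjTranspose_mulVec hZ, ← norm_toLp_sq]
    exact pow_le_pow_left₀ (norm_nonneg _) hv 2
  -- Spectral gap: off `k0` one has p_k ≤ a while Re s ≥ 1 - a, so each residual component is at
  -- least (1 - 2a)|y_k|.
  have htail : ∑ k ∈ Finset.univ.erase k0, ‖y k‖ ^ 2 ≤ χ ^ 2 := by
    rw [hχ, div_pow, le_div_iff₀ (by positivity), mul_comm, Finset.mul_sum]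
    refine le_trans (Finset.sum_le_sum fun k hk => ?_) ((Finset.sum_le_sum_of_subset_of_nonneg
      (Finset.subset_univ (Finset.univ.erase k0)) fun i _ _ => sq_nonneg _).trans hres)
    rw [norm_mul, mul_pow]
    gcongr
    have h1 := hoth k (Finset.ne_of_mem_erase hk)
    have h2 := Complex.re_le_norm (s - p k)
    rw [Complex.sub_re, Complex.ofReal_re] at h2
    rw [norm_sub_rev]
    simp only [γ]; linarith
  have hk0y : ‖y k0‖ ^ 2 + ∑ k ∈ Finset.univ.erase k0, ‖y k‖ ^ 2 = 1 := by
    rw [Finset.add_sum_erase _ (fun k => ‖y k‖ ^ 2) (Finset.mem_univ k0), hy1]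
  have hyle : ‖y k0‖ ≤ 1 := by
    have : 0 ≤ ∑ k ∈ Finset.univ.erase k0, ‖y k‖ ^ 2 := Finset.sum_nonneg fun k _ => sq_nonneg _
    nlinarith [norm_nonneg (y k0)]
  obtain ⟨ω, hω, hyω⟩ : ∃ ω : ℂ, ‖ω‖ = 1 ∧ y k0 = ‖y k0‖ * ω := by
    by_cases h : y k0 = 0
    · exact ⟨1, by simp, by simp [h]⟩
    · have h' : (‖y k0‖ : ℂ) ≠ 0 := by exact_mod_cast norm_ne_zero_iff.2 h
      refine ⟨y k0 / ‖y k0‖, ?_, by field_simp⟩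
      rw [norm_div, Complex.norm_real, norm_norm, div_self (norm_ne_zero_iff.2 h)]
  refine ⟨k0, hk0, ω, hω, ?_⟩
  rw [← sum_norm_sq_conjTranspose_mulVec hZ]
  have hcol : Zᴴ *ᵥ (Zᵀ k0) = Pi.single k0 1 := by
    ext i
    have := congrFun (congrFun hZZ i) k0
    rw [Matrix.one_apply] at this
    rw [Pi.single_apply, ← this]; rfl
  have hcomp : Zᴴ *ᵥ (ω • Zᵀ k0 - ψ) = ω • Pi.single k0 1 - y := by
    rw [Matrix.mulVec_sub, Matrix.mulVec_smul, hcol]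
  rw [hcomp, ← Finset.add_sum_erase _ (fun j => ‖(ω • (Pi.single k0 1 : n → ℂ) - y) j‖ ^ 2)
    (Finset.mem_univ k0)]
  have h1 : ‖(ω • (Pi.single k0 1 : n → ℂ) - y) k0‖ = 1 - ‖y k0‖ := by
    have : (ω • (Pi.single k0 1 : n → ℂ) - y) k0 = ((1 - ‖y k0‖ : ℝ) : ℂ) * ω := by
      simp only [Pi.sub_apply, Pi.smul_apply, Pi.single_eq_same, smul_eq_mul, mul_one]
      conv_lhs => rw [hyω]
      push_cast; ring
    rw [this, norm_mul, hω, mul_one, Complex.norm_real, Real.norm_of_nonneg (by linarith)]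
  have h2 : ∑ k ∈ Finset.univ.erase k0, ‖(ω • (Pi.single k0 1 : n → ℂ) - y) k‖ ^ 2
      = ∑ k ∈ Finset.univ.erase k0, ‖y k‖ ^ 2 := by
    refine Finset.sum_congr rfl fun k hk => ?_
    simp [Finset.ne_of_mem_erase hk]
  rw [h1, h2]
  -- Since |y_{k0}| ≤ 1, 1 - |y_{k0}| ≤ 1 - |y_{k0}|². The total is then χ⁴ + χ² ≤ (χ(1 + χ))².
  have h3 : 1 - ‖y k0‖ ≤ χ ^ 2 := by nlinarith [norm_nonneg (y k0)]
  have h4 : (1 - ‖y k0‖) ^ 2 ≤ (χ ^ 2) ^ 2 := pow_le_pow_left₀ (by linarith) h3 2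
  have h5 : 0 ≤ χ ^ 3 := by positivity
  nlinarith

lemma quadForm_phase_smul (X : Matrix n n ℂ) {ω : ℂ} (hω : ‖ω‖ = 1) (v : n → ℂ) :
    quadForm X (ω • v) = quadForm X v := by
  have h : star ω * ω = 1 := by
    rw [Complex.star_def, ← Complex.normSq_eq_conj_mul_self, Complex.normSq_eq_norm_sq, hω]
    simp
  rw [quadForm, star_smul, Matrix.mulVec_smul, smul_dotProduct, dotProduct_smul, smul_smul, h,
    one_smul, quadForm]

end TopEigenvector

/-! ### Upper bound for nearly pure states. -/

section Upper

variable {A B : Type*} [Fintype A] [DecidableEq A] [Fintype B] [DecidableEq B]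

lemma sum_sq_of_schmidt {U : Matrix A A ℂ} {V : Matrix B B ℂ}
    (hU : U ∈ Matrix.unitaryGroup A ℂ) (hV : V ∈ Matrix.unitaryGroup B ℂ) {m : A × B → ℝ}
    {v : A × B → ℂ} (hv : v = (U ⊗ₖ V) *ᵥ (fun k => (m k : ℂ))) (hv1 : ∑ k, ‖v k‖ ^ 2 = 1) :
    ∑ k, m k ^ 2 = 1 := by
  have hW := kronecker_mem_unitaryGroup hU hV
  have hWW : (U ⊗ₖ V)ᴴ * (U ⊗ₖ V) = 1 := Matrix.mem_unitaryGroup_iff'.1 hW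
  rw [← hv1, ← sum_norm_sq_conjTranspose_mulVec hW, hv, Matrix.mulVec_mulVec, hWW,
    Matrix.one_mulVec]
  refine Finset.sum_congr rfl fun k _ => ?_
  rw [Complex.norm_real, Real.norm_eq_abs, sq_abs]

/-- Every unit vector is at distance at most `2 ln d` from a separable state. -/
lemma exists_separable_near {v : A × B → ℂ} (hv1 : ∑ k, ‖v k‖ ^ 2 = 1) {x : ℝ} (hx0 : 0 < x)
    (hx1 : x < 1) : ∃ σ ∈ separableStates A B, σ.PosDef ∧ -quadForm (cfc Real.log σ) v ≤
      2 * Real.log (min (Fintype.card A) (Fintype.card B) : ℕ) - Real.log (1 - x) := by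
  obtain ⟨U, hU, V, hV, m, hm, hv⟩ := exists_schmidt v
  have hm1 := sum_sq_of_schmidt hU hV hv hv1
  refine ⟨_, schmidtState_mem hU hV hm1 hx0 hx1, schmidtState_posDef hU hV hm1 hx0 hx1, ?_⟩
  have h := neg_quadForm_log_schmidtState_le hU hV hm hm1 hx0 hx1 (e := 0) le_rfl (by simp)
  rw [add_zero, ← hv] at h
  have := hm.schmidtEntropy_le hm1
  linarith

/-- The relative entropy of entanglement of a nearly pure state, compared with the entropy of the
Schmidt coefficients of a vector close to its top eigenvector. -/
lemma relEntropyEntanglement_le_of_top {Z : Matrix (A × B) (A × B) ℂ}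
    (hZ : Z ∈ Matrix.unitaryGroup (A × B) ℂ) {p : A × B → ℝ} (hp : ∀ k, 0 ≤ p k)
    (hp1 : ∑ k, p k = 1) {U : Matrix A A ℂ} {V : Matrix B B ℂ}
    (hU : U ∈ Matrix.unitaryGroup A ℂ) (hV : V ∈ Matrix.unitaryGroup B ℂ) {m : A × B → ℝ}
    (hm : IsSchmidt m) (hm1 : ∑ k, m k ^ 2 = 1) {v : A × B → ℂ}
    (hv : v = (U ⊗ₖ V) *ᵥ (fun k => (m k : ℂ))) {x : ℝ} (hx0 : 0 < x) (hx1 : x < 1) {a η Y : ℝ}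
    (hη : 0 ≤ η) {k₀ : A × B} (hk₀ : 1 - a ≤ p k₀) {ω : ℂ} (hω : ‖ω‖ = 1)
    (hclose : ∑ j, ‖(ω • Zᵀ k₀ - v) j‖ ^ 2 ≤ η ^ 2) (hY : -Real.log (1 - x) ≤ Y) :
    relEntropyEntanglement (spectralMatrix Z p) ≤
      ((schmidtEntropy m + Y
        + 2 * η * (2 * Real.log (min (Fintype.card A) (Fintype.card B) : ℕ) + Y)
        + η ^ 2 * Real.log (Fintype.card (A × B) / x)
        + a * (2 * Real.log (min (Fintype.card A) (Fintype.card B) : ℕ) + Y) : ℝ) : EReal) := by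
  set l := Real.log (min (Fintype.card A) (Fintype.card B) : ℕ)
  have hl : 0 ≤ l := Real.log_natCast_nonneg _
  have hY0 : 0 ≤ Y := by
    have := Real.log_nonpos (by linarith : 0 ≤ 1 - x) (by linarith); linarith
  have hlog : 0 ≤ Real.log (Fintype.card (A × B) / x) := by
    have hN := card_pos_of_sum_sq hm1
    apply Real.log_nonneg
    rw [le_div_iff₀ hx0]
    have : (1 : ℝ) ≤ Fintype.card (A × B) := by exact_mod_cast Nat.cast_pos.1 hN
    linarith
  set b₀ := schmidtEntropy m + Y + 2 * η * (2 * l + Y)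
    + η ^ 2 * Real.log (Fintype.card (A × B) / x) with hb₀
  have hE := schmidtEntropy_nonneg hm1
  have hb₀0 : 0 ≤ b₀ := by positivity
  -- The top eigenvector uses the noisy Schmidt state of `v`, so that the entropy of `v` appears;
  -- every other eigenvector uses its own.
  have hex : ∀ k, ∃ σ ∈ separableStates A B, σ.PosDef ∧
      -quadForm (cfc Real.log σ) (Zᵀ k) ≤ if k = k₀ then b₀ else 2 * l + Y := by
    intro k
    by_cases hk : k = k₀
    · subst hk
      refine ⟨_, schmidtState_mem hU hV hm1 hx0 hx1, schmidtState_posDef hU hV hm1 hx0 hx1, ?_⟩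
      have h := neg_quadForm_log_schmidtState_le hU hV hm hm1 hx0 hx1 hη hclose
      rw [← hv, add_sub_cancel, quadForm_phase_smul _ hω] at h
      rw [if_pos rfl]
      refine h.trans ?_
      have : 2 * η * (2 * l - Real.log (1 - x)) ≤ 2 * η * (2 * l + Y) := by
        apply mul_le_mul_of_nonneg_left _ (by positivity)
        linarith
      simp only [hb₀]
      linarith
    · rw [if_neg hk]
      obtain ⟨σ, h1, h2, h3⟩ := exists_separable_near (v := Zᵀ k)
        (by rw [← quadForm_one]; exact quadForm_one_col hZ k) hx0 hx1
      exact ⟨σ, h1, h2, by linarith⟩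
  choose σ hσ hσp hb using hex
  refine (relEntropyEntanglement_le_sum hZ hp hp1 hσ hσp hb).trans ?_
  rw [EReal.coe_le_coe_iff, ← Finset.add_sum_erase _ _ (Finset.mem_univ k₀), if_pos rfl]
  have h1 : ∑ k ∈ Finset.univ.erase k₀, p k * (if k = k₀ then b₀ else 2 * l + Y)
      = (1 - p k₀) * (2 * l + Y) := by
    rw [← hp1, ← Finset.add_sum_erase _ _ (Finset.mem_univ k₀), add_sub_cancel_left,
      Finset.sum_mul]
    refine Finset.sum_congr rfl fun k hk => ?_
    rw [if_neg (Finset.ne_of_mem_erase hk)]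
  rw [h1]
  have hple : p k₀ ≤ 1 := by
    rw [← hp1]; exact Finset.single_le_sum (fun i _ => hp i) (Finset.mem_univ k₀)
  have h2 : p k₀ * b₀ ≤ b₀ := mul_le_of_le_one_left hb₀0 hple
  have h3 : (1 - p k₀) * (2 * l + Y) ≤ a * (2 * l + Y) := by
    apply mul_le_mul_of_nonneg_right (by linarith) (by positivity)
  linarith

end Upper

/-! ### The rate bound and its limit at time zero. -/

lemma toReal_le_of_le_coe {D : EReal} {X : ℝ} (h : D ≤ X) (hX : 0 ≤ X) : D.toReal ≤ X := by
  induction D with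
  | bot => simpa using hX
  | top => simp at h
  | coe r => simpa using h

/-- A bound for the entangling rate at time `t`, with `v` and `S` bounding the first order motion
and the loss of purity, `c` the norm of the generator, `l = ln d`, and `N` the total dimension. -/
noncomputable def rateBound (v S c l N t : ℝ) : ℝ :=
  t / (1 - t ^ 2)
    + 2 * ((v + c ^ 2 * t) / (1 - 2 * (t * (S + c ^ 2 * t)))
        * (1 + t * ((v + c ^ 2 * t) / (1 - 2 * (t * (S + c ^ 2 * t))))))
      * (2 * l + t ^ 2 / (1 - t ^ 2))
    + ((v + c ^ 2 * t) / (1 - 2 * (t * (S + c ^ 2 * t)))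
        * (1 + t * ((v + c ^ 2 * t) / (1 - 2 * (t * (S + c ^ 2 * t)))))) ^ 2
      * (t * Real.log N - 2 * (t * Real.log t))
    + (S + c ^ 2 * t) * (2 * l + t ^ 2 / (1 - t ^ 2))

/-- The noise contributes t ln t, which extends continuously by 0 with the convention `Real.log 0 =
0`; the other terms are rational in t. -/
lemma continuousAt_rateBound (v S c l N : ℝ) : ContinuousAt (rateBound v S c l N) 0 := by
  have h1 : ContinuousAt (fun t : ℝ => t * Real.log t) 0 := Real.continuous_mul_log.continuousAt
  have h2 : ContinuousAt (fun t : ℝ => t / (1 - t ^ 2)) 0 := by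
    apply ContinuousAt.div <;> first | fun_prop | norm_num
  have h3 : ContinuousAt (fun t : ℝ => t ^ 2 / (1 - t ^ 2)) 0 := by
    apply ContinuousAt.div <;> first | fun_prop | norm_num
  have h4 : ContinuousAt (fun t : ℝ => (v + c ^ 2 * t) / (1 - 2 * (t * (S + c ^ 2 * t)))) 0 := by
    apply ContinuousAt.div <;> first | fun_prop | norm_num
  unfold rateBound
  fun_prop

lemma rateBound_zero (v S c l N : ℝ) : rateBound v S c l N 0 = 4 * v * l + 2 * S * l := by
  simp [rateBound]; ring

section Rate

variable {A B : Type*} [Fintype A] [DecidableEq A] [Fintype B] [DecidableEq B]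
  {κ : Type*} [Fintype κ]

/-- The noise weight is x = t²: mixing costs O(t²), and the quadratic displacement term is O(t²
ln(1/t)). Both are o(t). -/
lemma entanglingRate_le_rateBound {H : Matrix (A × B) (A × B) ℂ} (hH : H.IsHermitian)
    {L : κ → Matrix (A × B) (A × B) ℂ} {Ψ : EuclideanSpace ℂ (A × B)} (hΨ : ‖Ψ‖ = 1)
    {ρ : ℝ → Matrix (A × B) (A × B) ℂ} (h0 : ρ 0 = pureState Ψ) (hρ : IsEvolution H L ρ) {t : ℝ}
    (ht : 0 < t) (ht1 : t < 1)
    (hta : 2 * (t * ((∑ α, ‖L α‖ ^ 2) + generatorBound H L ^ 2 * t)) < 1) :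
    entanglingRate ρ t ≤ rateBound (‖H‖ + 3 / 2 * ∑ α, ‖L α‖ ^ 2) (∑ α, ‖L α‖ ^ 2)
      (generatorBound H L) (Real.log (min (Fintype.card A) (Fintype.card B) : ℕ))
      (Fintype.card (A × B)) t := by
  set S := ∑ α, ‖L α‖ ^ 2 with hS
  have hS0 : 0 ≤ S := Finset.sum_nonneg fun α _ => sq_nonneg _
  set c := generatorBound H L
  set l := Real.log (min (Fintype.card A) (Fintype.card B) : ℕ) with hl
  have hl0 : 0 ≤ l := Real.log_natCast_nonneg _
  set v := ‖H‖ + 3 / 2 * S with hvdef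
  have hv0 : 0 ≤ v := by positivity
  set a := t * (S + c ^ 2 * t) with ha
  have hstate : IsState (ρ 0) := h0 ▸ isState_pureState hΨ
  have hnorm := hρ.norm_sub_le hH hstate ht.le
  rw [h0] at hnorm
  change _ ≤ c ^ 2 * t ^ 2 at hnorm
  set G := lindblad H L (pureState Ψ)
  set r := ρ t - pureState Ψ - t • G with hr
  have hρt : ρ t = pureState Ψ + t • G + r := by rw [hr]; abel
  have hst := hρ.isState hH hstate ht.le
  obtain ⟨Z, hZ, hspec⟩ := exists_spectralMatrix hst.1.1
  have hp := hst.1.eigenvalues_nonneg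
  generalize hst.1.1.eigenvalues = p at hspec hp
  have hp1 : ∑ k, p k = 1 := by
    have := hst.2
    rw [hspec, trace_spectralMatrix hZ] at this
    exact_mod_cast this
  have hψ1 := sum_norm_sq_eq_one hΨ
  have hq : 1 - a ≤ quadForm (spectralMatrix Z p) (fun i => Ψ i) := by
    rw [← hspec, hρt, quadForm_add, quadForm_add, quadForm_smul]
    have h1 : quadForm (pureState Ψ) (fun i => Ψ i) = 1 := by
      rw [quadForm, pureState_mulVec_self hΨ, star_dotProduct_of_norm_eq_one hΨ, Complex.one_re]
    have h2 : -S ≤ quadForm G (fun i => Ψ i) := neg_sum_le_quadForm_lindblad hΨ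
    have h3 := (neg_le_of_abs_le (abs_quadForm_le r (fun i => Ψ i)))
    rw [norm_toLp_sq, hψ1, mul_one] at h3
    have h4 := mul_le_mul_of_nonneg_left h2 ht.le
    rw [h1, ha]
    linarith
  obtain ⟨g, u, hG, hg, hu⟩ := exists_lindblad_pureState_mulVec (L := L) hH hΨ
  change -S ≤ g.re at hg
  change _ ≤ v at hu
  have hs : 1 - a ≤ (1 + t * g).re := by
    have h4 := mul_le_mul_of_nonneg_left hg ht.le
    have h5 : 0 ≤ c ^ 2 * t ^ 2 := by positivity
    rw [Complex.add_re, Complex.one_re, Complex.re_ofReal_mul, ha]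
    linarith
  have hvec : ‖WithLp.toLp 2 (spectralMatrix Z p *ᵥ (fun i => Ψ i)
      - (1 + t * g) • (fun i => Ψ i))‖ ≤ t * (v + c ^ 2 * t) := by
    have h1 : spectralMatrix Z p *ᵥ (fun i => Ψ i) - (1 + t * g) • (fun i => Ψ i)
        = (t : ℂ) • u + r *ᵥ (fun i => Ψ i) := by
      rw [← hspec, hρt, Matrix.add_mulVec, Matrix.add_mulVec, pureState_mulVec_self hΨ,
        Matrix.smul_mulVec, hG, add_smul, one_smul, mul_smul, smul_add,
        ← Complex.coe_smul t, ← Complex.coe_smul t]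
      abel
    rw [h1, WithLp.toLp_add, WithLp.toLp_smul]
    refine (norm_add_le _ _).trans ?_
    rw [norm_smul, Complex.norm_real, Real.norm_of_nonneg ht.le]
    have h2 := norm_toLp_mulVec_le_norm hΨ r
    have h3 := mul_le_mul_of_nonneg_left hu ht.le
    linarith
  have hβ : 0 ≤ t * (v + c ^ 2 * t) := by positivity
  obtain ⟨k₀, hk₀, ω, hω, hclose⟩ := exists_top_eigenvector hZ hp hp1 hψ1 hta hβ hq hs hvec
  obtain ⟨U, hU, V, hV, m, hm, hsch⟩ := exists_schmidt (fun i => Ψ i)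
  have hm1 := sum_sq_of_schmidt hU hV hsch hψ1
  have hγ : 0 < 1 - 2 * a := by linarith
  set χ := (v + c ^ 2 * t) / (1 - 2 * a) with hχ
  have hχ0 : 0 ≤ χ := by positivity
  have hη : t * (v + c ^ 2 * t) / (1 - 2 * a) * (1 + t * (v + c ^ 2 * t) / (1 - 2 * a))
      = t * (χ * (1 + t * χ)) := by
    rw [hχ, mul_div_assoc]; ring
  rw [hη] at hclose
  have ht2 : t ^ 2 < 1 := by nlinarith
  have hY : -Real.log (1 - t ^ 2) ≤ t ^ 2 / (1 - t ^ 2) := by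
    have h1 := Real.one_sub_inv_le_log_of_pos (by linarith : 0 < 1 - t ^ 2)
    have h2 : t ^ 2 / (1 - t ^ 2) = (1 - t ^ 2)⁻¹ - 1 := by
      have : 1 - t ^ 2 ≠ 0 := by linarith
      field_simp
      ring
    linarith
  have hup := relEntropyEntanglement_le_of_top hZ hp hp1 hU hV hm hm1 hsch
    (by positivity : 0 < t ^ 2) ht2 (by positivity : 0 ≤ t * (χ * (1 + t * χ))) hk₀ hω hclose hY
  rw [← hspec, ← hl] at hup
  have hN := card_pos_of_sum_sq hm1
  have hlogN : Real.log (Fintype.card (A × B) / t ^ 2)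
      = Real.log (Fintype.card (A × B)) - 2 * Real.log t := by
    rw [Real.log_div hN.ne' (by positivity), Real.log_pow]; norm_num
  have hlog0 : 0 ≤ Real.log (Fintype.card (A × B) / t ^ 2) := by
    apply Real.log_nonneg
    rw [le_div_iff₀ (by positivity)]
    have : (1 : ℝ) ≤ Fintype.card (A × B) := by exact_mod_cast Nat.cast_pos.1 hN
    linarith
  have hY0 : 0 ≤ t ^ 2 / (1 - t ^ 2) := div_nonneg (sq_nonneg _) (by linarith)
  have ha0 : 0 ≤ a := by positivity
  have hE := schmidtEntropy_nonneg hm1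
  have hup' := toReal_le_of_le_coe hup (by positivity)
  have hlow := schmidtEntropy_le_toReal hΨ hU hV hm hm1 hsch
  rw [entanglingRate, h0, div_le_iff₀ ht]
  have hfin : rateBound v S c l (Fintype.card (A × B)) t * t
      = t ^ 2 / (1 - t ^ 2) + 2 * (t * (χ * (1 + t * χ))) * (2 * l + t ^ 2 / (1 - t ^ 2))
        + (t * (χ * (1 + t * χ))) ^ 2 * Real.log (Fintype.card (A × B) / t ^ 2)
        + a * (2 * l + t ^ 2 / (1 - t ^ 2)) := by
    rw [rateBound, hlogN, ← ha, ← hχ, ha]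
    have : t / (1 - t ^ 2) * t = t ^ 2 / (1 - t ^ 2) := by ring
    linear_combination this
  rw [hfin]
  linarith

end Rate

end EntRate

theorem theorem2 (dA dB : ℕ) {κ : Type*} [Fintype κ]
    (H : Matrix (Fin dA × Fin dB) (Fin dA × Fin dB) ℂ) (hH : H.IsHermitian)
    (L : κ → Matrix (Fin dA × Fin dB) (Fin dA × Fin dB) ℂ) :
    ∀ ε : ℝ, 0 < ε → ∃ δ : ℝ, 0 < δ ∧
      ∀ Ψ : EuclideanSpace ℂ (Fin dA × Fin dB), ‖Ψ‖ = 1 →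
      ∀ ρ : ℝ → Matrix (Fin dA × Fin dB) (Fin dA × Fin dB) ℂ,
        ρ 0 = EntRate.pureState Ψ → EntRate.IsEvolution H L ρ →
        ∀ Δt : ℝ, 0 < Δt → Δt < δ →
          EntRate.entanglingRate ρ Δt ≤
            4 * (‖H‖ + 86 * ∑ α, ‖L α‖ ^ 2) * Real.log ((min dA dB : ℕ) : ℝ) + ε := by
  intro ε hε
  set S := ∑ α, ‖L α‖ ^ 2
  set c := EntRate.generatorBound H L
  set l := Real.log ((min dA dB : ℕ) : ℝ)
  have hS0 : 0 ≤ S := Finset.sum_nonneg fun α _ => sq_nonneg _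
  have hl0 : 0 ≤ l := Real.log_natCast_nonneg _
  have hcont := EntRate.continuousAt_rateBound (‖H‖ + 3 / 2 * S) S c l
    (Fintype.card (Fin dA × Fin dB))
  -- The limit is 4(‖H‖ + 2S) ln d, so the constant 86 leaves ample room; ε makes the inequality
  -- strict even when ln d = 0.
  have hlim : EntRate.rateBound (‖H‖ + 3 / 2 * S) S c l (Fintype.card (Fin dA × Fin dB)) 0
      < 4 * (‖H‖ + 86 * S) * l + ε := by
    rw [EntRate.rateBound_zero]
    nlinarith [mul_nonneg hS0 hl0]
  -- Keeps the spectral gap open for small t. The state Ψ enters none of these conditions, so δ is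
  -- uniform.
  have hsmall : ContinuousAt (fun t : ℝ => 2 * (t * (S + c ^ 2 * t))) 0 := by fun_prop
  have hev := (hcont.eventually_lt continuousAt_const hlim).and
    ((hsmall.eventually_lt (continuousAt_const (y := (1 : ℝ))) (by simp)).and
      (Iio_mem_nhds (zero_lt_one (α := ℝ))))
  obtain ⟨δ, hδ, hball⟩ := Metric.eventually_nhds_iff.1 hev
  refine ⟨δ, hδ, fun Ψ hΨ ρ h0 hρ t ht htδ => ?_⟩
  obtain ⟨h1, h2, h3⟩ := hball (y := t) (by
    rwa [Real.dist_eq, sub_zero, abs_of_pos ht])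
  have h := EntRate.entanglingRate_le_rateBound hH hΨ h0 hρ ht h3 h2
  rw [Fintype.card_fin, Fintype.card_fin] at h
  exact h.trans h1.le
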